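/- Let $d\ge 2$, let $(G_n)_{n\in\mathbb{N}}$ be a family of groups, and for each $n$ let $\rho_n\colon G_n\to S_n$ be a homomorphism and $\kappa_k^n\colon G_n\to G_{n+d-1}$ ($1\le k\le n$) injective functions, written to the right of their arguments. Let $\varsigma_k^n\colon S_n\to S_{n+d-1}$ be the standard $d$-ary cloning maps, which replace the $k$th strand of a permutation by $d$ parallel strands. Suppose that these data form a $d$-ary cloning system, that is, for all $n$ and $g,h\in G_n$: * (C1) $(gh)\kappa_k^n=(g)\kappa_{\rho_n(h)k}^n\,(h)\kappa_k^n$ for $1\le k\le n$; * (C2) $((g)\kappa_\ell^n)\kappa_k^{n+d-1}=((g)\kappa_k^n)\kappa_{\ell+d-1}^{n+d-1}$ for $1\le k<\ell\le n$; * (C3) $\rho_{n+d-1}((g)\kappa_k^n)(i)=(\rho_n(g))\varsigma_k^n(i)$ for $1\le k\le n$ and all $i\in\{1,\dots,n+d-1\}\setminus\{k,\dots,k+d-1\}$. Let $\mathscr{T}_d(G_*)$ be the associated Thompson-like group. Its elements are the equivalence classes $[T_-,g,T_+]$ of triples in which $T_\pm$ are finite rooted ordered $d$-ary trees with the same number $n$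 of leaves and $g\in G_n$. The equivalence relation is generated by the expansions $(T_-,g,T_+)\sim(T_-',(g)\kappa_k^n,T_+')$, where $T_+'$ is $T_+$ with a $d$-ary caret added to its $k$th leaf and $T_-'$ is $T_-$ with a $d$-ary caret added to its $\rho_n(g)(k)$th leaf. The product is determined by $[T,g,S][S,h,U]=[T,gh,U]$. Assume that the cloning system is *fully compatible*, i.e. the equality in (C3) holds for all $1\le k\le n$ and all $1\le i\le n+d-1$, and *diverse*, i.e. $\bigcap_{k=1}^n (G_n)\kappa_k^n=\{1\}$ for all sufficiently large $n$. Then $\mathscr{T}_d(G_*)$ is ICC: the conjugacy class of every non-trivial element is infinite. Moreover, the group von Neumann algebra $\mathcal{L}(\mathscr{T}_d(G_*))$, that is, the closure of $\mathbb{C}[\mathscr{T}_d(G_*)]$ in $\mathcal{B}(\ell^2(\mathscr{T}_d(G_*)))$ in the weak operator topology, where the group acts by left translations, is a type $\mathrm{II}_1$ factor: its center consists of the scalar multiples of the identity, it is infinite dimensional, and it admits a trace state. (No assumption that the $G_n$ are ICC is made.) -/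

import Mathlib

/-- Finite rooted ordered `d`-ary trees: every non-leaf vertex has `d` ordered children. -/
inductive DTree (d : ℕ) : Type
  | leaf : DTree d
  | node : (Fin d → DTree d) → DTree d

namespace DTree

variable {d : ℕ}

/-- The number of leaves of a tree. -/
def numLeaves : DTree d → ℕ
  | leaf => 1
  | node c => ∑ i, numLeaves (c i)

/-- The number of leaves lying to the left of the `i`th subtree below the root. -/
def offset (c : Fin d → DTree d) (i : Fin d) : ℕ :=
  ∑ j ∈ Finset.Iio i, (c j).numLeaves

/-- The `d`-ary caret: the tree whose root has `d` children, all of which are leaves. -/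
def caret : DTree d := node fun _ => leaf

/-- `addCaret T k` is `T` with a `d`-ary caret added to the leaf number `k`, the leaves being
numbered `0, …, n - 1` from left to right; there is no change if there is no leaf number `k`.
(Allowing `k` to be an arbitrary integer makes the recursion uniform: in the subtrees that do not
contain the leaf in question the shifted number is out of range.) -/
def addCaret : DTree d → ℤ → DTree d
  | leaf, k => if k = 0 then caret else leaf
  | node c, k => node fun i => addCaret (c i) (k - offset c i)

/-- `S.le T`: the tree `T` contains the tree `S` (with the same root). -/
def le : DTree d → DTree d → Prop
  | leaf, _ => True
  | node _, leaf => False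
  | node c, node c' => ∀ i, le (c i) (c' i)

/-- The union of two trees. -/
def sup : DTree d → DTree d → DTree d
  | leaf, T => T
  | node c, leaf => node c
  | node c, node c' => node fun i => sup (c i) (c' i)

theorem le_refl (T : DTree d) : T.le T := by
  induction T with
  | leaf => trivial
  | node c ih => exact ih

theorem le_trans {S T U : DTree d} (h : S.le T) (h' : T.le U) : S.le U := by
  induction S generalizing T U with
  | leaf => trivial
  | node c ih =>
    cases T with
    | leaf => exact h.elim
    | node c' =>
      cases U with
      | leaf => exact h'.elim
      | node c'' => exact fun i => ih i (h i) (h' i)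

theorem le_sup_left (S T : DTree d) : S.le (S.sup T) := by
  induction S generalizing T with
  | leaf => trivial
  | node c ih =>
    cases T with
    | leaf => exact le_refl _
    | node c' => exact fun i => ih i _

theorem le_sup_right (S T : DTree d) : T.le (S.sup T) := by
  induction S generalizing T with
  | leaf => exact le_refl _
  | node c ih =>
    cases T with
    | leaf => trivial
    | node c' => exact fun i => ih i _

theorem numLeaves_mono (hd : 1 ≤ d) {S T : DTree d} (h : S.le T) :
    S.numLeaves ≤ T.numLeaves := by
  have pos : ∀ T : DTree d, 1 ≤ T.numLeaves := by
    intro T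
    induction T with
    | leaf => exact Nat.le_refl _
    | node c ih =>
      exact (ih ⟨0, hd⟩).trans (Finset.single_le_sum (f := fun i => (c i).numLeaves)
        (fun _ _ => Nat.zero_le _) (Finset.mem_univ _))
  induction S generalizing T with
  | leaf => exact pos T
  | node c ih =>
    cases T with
    | leaf => exact h.elim
    | node c' => exact Finset.sum_le_sum fun i _ => ih i (h i)

theorem offset_add_le (c : Fin d → DTree d) {i j : Fin d} (h : i < j) :
    offset c i + (c i).numLeaves ≤ offset c j := by
  unfold offset
  rw [add_comm, ← Finset.sum_insert (f := fun j => (c j).numLeaves) (by simp)]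
  apply Finset.sum_le_sum_of_subset
  intro x hx
  simp only [Finset.mem_insert, Finset.mem_Iio] at hx ⊢
  rcases hx with rfl | hx
  · exact h
  · exact hx.trans h

theorem offset_add_le_total (c : Fin d → DTree d) (i : Fin d) :
    offset c i + (c i).numLeaves ≤ (node c).numLeaves := by
  change offset c i + (c i).numLeaves ≤ ∑ j, (c j).numLeaves
  unfold offset
  rw [add_comm, ← Finset.sum_insert (f := fun j => (c j).numLeaves) (by simp)]
  exact Finset.sum_le_sum_of_subset (Finset.subset_univ _)

theorem exists_block (c : Fin d → DTree d) (k : ℕ) (hk : k < (node c).numLeaves) :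
    ∃ i, offset c i ≤ k ∧ k < offset c i + (c i).numLeaves := by
  by_contra! H
  have key : ∀ m ≤ d, ∑ j : Fin d with j.val < m, (c j).numLeaves ≤ k := by
    intro m
    induction m with
    | zero => intro _; simp
    | succ m ih =>
      intro hm
      have h1 := H ⟨m, hm⟩ (by
        convert ih (by omega) using 1
        unfold offset
        congr 1
        ext j
        simp [Fin.lt_def])
      refine le_of_eq_of_le ?_ h1
      unfold offset
      rw [add_comm (Finset.sum _ _), ← Finset.sum_insert (f := fun j => (c j).numLeaves) (by simp)]
      congr 1
      ext j
      simp only [Finset.mem_filter, Finset.mem_univ, true_and, Finset.mem_insert,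
        Finset.mem_Iio, Fin.ext_iff, Fin.lt_def]
      omega
  have := key d (Nat.le_refl d)
  simp only [Fin.is_lt, Finset.filter_true] at this
  unfold numLeaves at hk
  omega

theorem addCaret_of_neg (T : DTree d) {k : ℤ} (hk : k < 0) : T.addCaret k = T := by
  induction T generalizing k with
  | leaf => simp [addCaret, hk.ne]
  | node c ih =>
    simp only [addCaret]
    congr 1
    funext i
    exact ih i (by omega)

theorem addCaret_of_ge (T : DTree d) {k : ℤ} (hk : (T.numLeaves : ℤ) ≤ k) :
    T.addCaret k = T := by
  induction T generalizing k with
  | leaf => simp only [numLeaves] at hk; simp [addCaret, show k ≠ 0 by omega]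
  | node c ih =>
    simp only [addCaret]
    congr 1
    funext i
    have := offset_add_le_total c i
    exact ih i (by omega)

theorem addCaret_node (c : Fin d → DTree d) (i : Fin d) {k : ℤ} (h1 : (offset c i : ℤ) ≤ k)
    (h2 : k < offset c i + (c i).numLeaves) :
    (node c).addCaret k = node (Function.update c i ((c i).addCaret (k - offset c i))) := by
  simp only [addCaret]
  congr 1
  funext j
  rcases lt_trichotomy i j with h | h | h
  · rw [Function.update_of_ne h.ne', addCaret_of_neg]
    have := offset_add_le c h
    omega
  · subst h
    simp
  · rw [Function.update_of_ne h.ne, addCaret_of_ge]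
    have := offset_add_le c h
    omega

theorem sum_update (c : Fin d → DTree d) (i : Fin d) (t : DTree d) (s : Finset (Fin d))
    (hi : i ∈ s) : ∑ j ∈ s, (Function.update c i t j).numLeaves + (c i).numLeaves =
      ∑ j ∈ s, (c j).numLeaves + t.numLeaves := by
  rw [← Finset.sum_erase_add _ _ hi, ← Finset.sum_erase_add (a := i) s (fun j => (c j).numLeaves)
    hi, Function.update_self]
  rw [Finset.sum_congr rfl (g := fun j => (c j).numLeaves)]
  · omega
  · intro j hj
    rw [Function.update_of_ne (Finset.ne_of_mem_erase hj)]

theorem numLeaves_addCaret (hd : 1 ≤ d) (T : DTree d) {k : ℤ} (h0 : 0 ≤ k)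
    (hk : k < T.numLeaves) : (T.addCaret k).numLeaves = T.numLeaves + (d - 1) := by
  induction T generalizing k with
  | leaf =>
    simp only [numLeaves] at hk
    have : k = 0 := by omega
    simp only [addCaret, this, if_true, caret, numLeaves, Finset.sum_const, Finset.card_univ,
      Fintype.card_fin, smul_eq_mul, mul_one]
    omega
  | node c ih =>
    obtain ⟨i, h1, h2⟩ := exists_block c k.toNat (by omega)
    rw [addCaret_node c i (by omega) (by omega)]
    have h3 := ih i (k := k - offset c i) (by omega) (by omega)
    have h4 := sum_update c i ((c i).addCaret (k - offset c i)) Finset.univ (Finset.mem_univ _)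
    simp only [numLeaves]
    omega

theorem offset_update_of_le (c : Fin d → DTree d) {i j : Fin d} (t : DTree d) (h : j ≤ i) :
    offset (Function.update c i t) j = offset c j := by
  unfold offset
  refine Finset.sum_congr rfl fun x hx => ?_
  rw [Function.update_of_ne (ne_of_lt ((Finset.mem_Iio.1 hx).trans_le h))]

theorem offset_update_of_lt (c : Fin d → DTree d) {i j : Fin d} (t : DTree d) (h : i < j) :
    offset (Function.update c i t) j + (c i).numLeaves = offset c j + t.numLeaves :=
  sum_update c i t _ (Finset.mem_Iio.2 h)

theorem addCaret_comm (hd : 1 ≤ d) (T : DTree d) {k l : ℤ} (h0 : 0 ≤ k) (hkl : k < l)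
    (hl : l < T.numLeaves) :
    (T.addCaret l).addCaret k = (T.addCaret k).addCaret (l + (d - 1 : ℕ)) := by
  induction T generalizing k l with
  | leaf => simp only [numLeaves] at hl; omega
  | node c ih =>
    obtain ⟨i, hi1, hi2⟩ := exists_block c k.toNat (by omega)
    obtain ⟨j, hj1, hj2⟩ := exists_block c l.toNat (by omega)
    have hij : i ≤ j := by
      by_contra! h
      have := offset_add_le c h
      omega
    have hni := numLeaves_addCaret hd (c i) (k := k - offset c i) (by omega) (by omega)
    have hnj := numLeaves_addCaret hd (c j) (k := l - offset c j) (by omega) (by omega)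
    rw [addCaret_node c i (k := k) (by omega) (by omega),
      addCaret_node c j (k := l) (by omega) (by omega)]
    have ho1 := offset_update_of_le c ((c j).addCaret (l - offset c j)) hij
    rcases hij.eq_or_lt with rfl | hlt
    · have ho2 := offset_update_of_le c ((c i).addCaret (k - offset c i)) hij
      rw [addCaret_node _ i, addCaret_node _ i]
      · simp only [Function.update_self, Function.update_idem, ho1, ho2]
        rw [ih i (by omega) (by omega) (by omega)]
        rw [show l - (offset c i : ℤ) + (d - 1 : ℕ) = l + (d - 1 : ℕ) - offset c i by ring]
      all_goals simp only [Function.update_self, ho1, ho2]; omega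
    · have ho2 := offset_update_of_lt c ((c i).addCaret (k - offset c i)) hlt
      have ho3 : offset (Function.update c i ((c i).addCaret (k - offset c i))) j =
        offset c j + (d - 1) := by omega
      rw [addCaret_node _ i, addCaret_node _ j]
      · rw [Function.update_of_ne hlt.ne, Function.update_of_ne hlt.ne', ho1, ho3,
          Function.update_comm hlt.ne]
        congr 4
        push_cast
        ring
      all_goals
        simp only [Function.update_of_ne hlt.ne, Function.update_of_ne hlt.ne', ho1, ho3]; omega

theorem le_addCaret (T : DTree d) (k : ℤ) : T.le (T.addCaret k) := by
  induction T generalizing k with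
  | leaf => trivial
  | node c ih => exact fun i => ih i _

theorem addCaret_le_of_le (hd : 1 ≤ d) {T W : DTree d} {k l : ℤ} (hkl : k < l)
    (hk : (T.addCaret k).le W) (hl : (T.addCaret l).le W) :
    ((T.addCaret l).addCaret k).le W := by
  induction T generalizing k l W with
  | leaf =>
    by_cases h : l = 0
    · rw [addCaret_of_neg _ (by omega)]
      exact hl
    · rw [show (leaf : DTree d).addCaret l = leaf by simp [addCaret, h]]
      exact hk
  | node c ih =>
    by_cases hneg : k < 0
    · rw [addCaret_of_neg _ hneg]
      exact hl
    by_cases hbig : ((node c).numLeaves : ℤ) ≤ l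
    · rw [addCaret_of_ge _ hbig]
      exact hk
    obtain ⟨j, hj1, hj2⟩ := exists_block c l.toNat (by omega)
    cases W with
    | leaf => exact hk.elim
    | node w =>
      have key : ∀ i, offset (Function.update c j ((c j).addCaret (l - offset c j))) i =
          offset c i ∨ l < offset c i := by
        intro i
        rcases le_or_gt i j with h | h
        · exact Or.inl (offset_update_of_le c _ h)
        · have := offset_add_le c h
          right
          omega
      intro i
      have e := addCaret_node c j (k := l) (by omega) (by omega)
      have e1 : (fun i => (c i).addCaret (l - offset c i)) =
        Function.update c j ((c j).addCaret (l - offset c j)) := by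
        simpa only [addCaret, node.injEq] using e
      have goal : (((c i).addCaret (l - offset c i)).addCaret
          (k - offset (fun i => (c i).addCaret (l - offset c i)) i)).le (w i) := by
        rcases key i with h | h
        · rw [e1, h]
          exact ih i (by omega) (hk i) (hl i)
        · rw [addCaret_of_neg _ (k := l - offset c i) (by omega), addCaret_of_neg]
          · exact le_trans (le_addCaret _ _) (hk i)
          · rcases lt_or_ge j i with h' | h'
            · have h3 := offset_update_of_lt c ((c j).addCaret (l - offset c j)) h'
              have h4 := numLeaves_addCaret hd (c j) (k := l - offset c j) (by omega) (by omega)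
              rw [e1]
              omega
            · have h3 := offset_update_of_le c ((c j).addCaret (l - offset c j)) h'
              rw [e1]
              omega
      exact goal

theorem exists_addCaret_le {S W : DTree d} (h : S.le W) :
    S = W ∨ ∃ k : ℕ, k < S.numLeaves ∧ (S.addCaret k).le W := by
  induction S generalizing W with
  | leaf =>
    cases W with
    | leaf => exact Or.inl rfl
    | node w =>
      refine Or.inr ⟨0, by simp [numLeaves], ?_⟩
      simp only [addCaret, Nat.cast_zero, if_true, caret]
      exact fun i => trivial
  | node c ih =>
    cases W with
    | leaf => exact h.elim
    | node w =>
      by_cases hc : c = w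
      · exact Or.inl (congrArg node hc)
      · right
        obtain ⟨i, hi⟩ := Function.ne_iff.1 hc
        obtain ⟨k, hk, hle⟩ := (ih i (h i)).resolve_left hi
        have ht := offset_add_le_total c i
        refine ⟨offset c i + k, by omega, ?_⟩
        rw [addCaret_node c i (by push_cast; omega) (by push_cast; omega)]
        intro j
        by_cases hj : j = i
        · subst hj
          simpa using hle
        · rw [Function.update_of_ne hj]
          exact h j

end DTree

/-- If the `k`th of `n` strands is replaced by `d` parallel strands (everything being counted from
`0`), then the `i`th of the resulting `n + d - 1` strands comes from the original strand number
`cloneStrand d n k i`. -/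
def cloneStrand (d n : ℕ) (k : Fin n) (i : Fin (n + (d - 1))) : Fin n :=
  ⟨if i.val < k.val then i.val else if i.val ≤ k.val + (d - 1) then k.val else i.val - (d - 1), by
    split_ifs <;> omega⟩

/-- The standard `d`-ary cloning map `S_n → S_{n+d-1}`, `σ ↦ (σ)ς_k`, on the level of values:
the `k`th strand of `σ` is replaced by `d` parallel strands. That is, the `d` points
`k, …, k + d - 1` are sent in order to `σ k, …, σ k + d - 1`, and every other point is sent where
`σ` sends the corresponding point `p`, shifted by `d - 1` if `σ p` lies beyond `σ k`. -/
def standardCloneFun (d n : ℕ) (k : Fin n) (σ : Equiv.Perm (Fin n)) (i : Fin (n + (d - 1))) :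
    Fin (n + (d - 1)) :=
  ⟨if cloneStrand d n k i = k then (σ k).val + (i.val - k.val)
    else if σ (cloneStrand d n k i) < σ k then (σ (cloneStrand d n k i)).val
    else (σ (cloneStrand d n k i)).val + (d - 1), by
    have := (σ k).isLt
    have := (σ (cloneStrand d n k i)).isLt
    split_ifs with h
    · simp only [cloneStrand, Fin.ext_iff] at h
      split_ifs at h <;> omega
    all_goals omega⟩

theorem standardCloneFun_injective (d n : ℕ) (k : Fin n) (σ : Equiv.Perm (Fin n)) :
    Function.Injective (standardCloneFun d n k σ) := by
  have ne : ∀ a b : Fin n, a ≠ b → (σ a).val ≠ (σ b).val := fun a b h h' =>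
    h (σ.injective (Fin.ext h'))
  have key : ∀ i, cloneStrand d n k i = k → k.val ≤ i.val ∧ i.val ≤ k.val + (d - 1) := by
    intro i h
    simp only [cloneStrand, Fin.ext_iff] at h
    split_ifs at h <;> omega
  intro i j hij
  have hij := congrArg Fin.val hij
  simp only [standardCloneFun, Fin.lt_def] at hij
  by_cases hs : cloneStrand d n k i = cloneStrand d n k j
  · rw [← hs] at hij
    have h1 := key i
    have h2 := key j
    rw [← hs] at h2
    by_cases hk : cloneStrand d n k i = k
    · simp only [hk, if_true] at hij
      have := h1 hk
      have := h2 hk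
      ext
      omega
    · have hk' : cloneStrand d n k j ≠ k := hs ▸ hk
      simp only [cloneStrand, Fin.ext_iff, ne_eq] at hs hk hk'
      ext
      split_ifs at hs hk hk' <;> omega
  · exfalso
    have h1 := ne _ _ hs
    have h2 := ne (cloneStrand d n k i) k
    have h3 := ne (cloneStrand d n k j) k
    have h4 := key i
    have h5 := key j
    by_cases hi : cloneStrand d n k i = k <;> by_cases hj : cloneStrand d n k j = k
    · exact hs (hi.trans hj.symm)
    · have h3 := h3 hj
      have h4 := h4 hi
      rw [if_pos hi, if_neg hj] at hij
      split_ifs at hij <;> omega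
    · have h2 := h2 hi
      have h5 := h5 hj
      rw [if_neg hi, if_pos hj] at hij
      split_ifs at hij <;> omega
    · have h2 := h2 hi
      have h3 := h3 hj
      rw [if_neg hi, if_neg hj] at hij
      split_ifs at hij <;> omega

/-- The standard `d`-ary cloning map `σ ↦ (σ)ς_k` from `S_n` to `S_{n+d-1}`. -/
noncomputable def standardClone (d n : ℕ) (k : Fin n) (σ : Equiv.Perm (Fin n)) :
    Equiv.Perm (Fin (n + (d - 1))) :=
  Equiv.ofBijective (standardCloneFun d n k σ)
    (Finite.injective_iff_bijective.1 (standardCloneFun_injective d n k σ))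

/-- A `d`-ary cloning system on a family of groups `G 0, G 1, G 2, …`. Here
`κ n k g` is the element `(g)κ_k^n`, and indices `1, …, n` are replaced by `0, …, n - 1`. (The group
`G 0` plays no role, as there are no cloning maps `κ_k^0`.) -/
structure CloningSystem (d : ℕ) (G : ℕ → Type*) [∀ n, Group (G n)] where
  two_le : 2 ≤ d
  /-- the representation maps -/
  ρ : ∀ n, G n →* Equiv.Perm (Fin n)
  /-- the cloning maps -/
  κ : ∀ n, Fin n → G n → G (n + (d - 1))
  κ_injective : ∀ n k, Function.Injective (κ n k)
  /-- cloning a product -/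
  κ_mul : ∀ n (k : Fin n) (g h : G n), κ n k (g * h) = κ n (ρ n h k) g * κ n k h
  /-- product of clonings -/
  κ_κ : ∀ n (k l : Fin n) (g : G n), k < l →
    κ (n + (d - 1)) (k.castAdd (d - 1)) (κ n l g) = κ (n + (d - 1)) (l.addNat (d - 1)) (κ n k g)
  /-- compatibility -/
  ρ_κ : ∀ n (k : Fin n) (g : G n) (i : Fin (n + (d - 1))), (i.val < k.val ∨ k.val + (d - 1) < i.val) →
    ρ (n + (d - 1)) (κ n k g) i = standardClone d n k (ρ n g) i

/-- A triple `(T₋, g, T₊)` where `T₋` and `T₊` are `d`-ary trees with the same number `n` of leaves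
and `g` is an element of `G n`. -/
structure TreeTriple (d : ℕ) (G : ℕ → Type*) where
  n : ℕ
  minus : DTree d
  elt : G n
  plus : DTree d
  minus_leaves : minus.numLeaves = n
  plus_leaves : plus.numLeaves = n

theorem TreeTriple.mk_congr {d : ℕ} {G : ℕ → Type*} {n : ℕ} {T T' S S' : DTree d} {g g' : G n} {h1 : T.numLeaves = n}
    {h2 : S.numLeaves = n} {h3 : T'.numLeaves = n} {h4 : S'.numLeaves = n}
    (hT : T = T') (hg : g = g') (hS : S = S') :
    (⟨n, T, g, S, h1, h2⟩ : TreeTriple d G) = ⟨n, T', g', S', h3, h4⟩ := by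
  subst hT hg hS
  rfl

namespace CloningSystem

variable {d : ℕ} {G : ℕ → Type*} [∀ n, Group (G n)] (C : CloningSystem d G)

/-- The compatibility condition holds for all points, without exceptions. -/
def FullyCompatible : Prop :=
  ∀ n (k : Fin n) (g : G n) (i : Fin (n + (d - 1))),
    C.ρ (n + (d - 1)) (C.κ n k g) i = standardClone d n k (C.ρ n g) i

/-- For all sufficiently large `n`, the images of the cloning maps `κ_k^n`, `1 ≤ k ≤ n`,
intersect trivially. -/
def Diverse : Prop :=
  ∃ N : ℕ, ∀ n ≥ N, ⋂ k : Fin n, Set.range (C.κ n k) = {1}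

theorem κ_one (n : ℕ) (k : Fin n) : C.κ n k 1 = 1 := by
  have := C.κ_mul n k 1 1
  simpa using this

theorem one_le (C : CloningSystem d G) : 1 ≤ d := by
  have := C.two_le
  omega

/-- The expansion `(T₋', (g)κ_k, T₊')` of `(T₋, g, T₊)`, where `T₊'` is `T₊` with a caret added to
the `k`th leaf and `T₋'` is `T₋` with a caret added to the `ρ(g)(k)`th leaf. -/
def expand (t : TreeTriple d G) (k : Fin t.n) : TreeTriple d G where
  n := t.n + (d - 1)
  minus := t.minus.addCaret (C.ρ t.n t.elt k).val
  elt := C.κ t.n k t.elt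
  plus := t.plus.addCaret k.val
  minus_leaves := by
    rw [DTree.numLeaves_addCaret C.one_le _ (by omega), t.minus_leaves]
    rw [t.minus_leaves]
    exact_mod_cast (C.ρ t.n t.elt k).isLt
  plus_leaves := by
    rw [DTree.numLeaves_addCaret C.one_le _ (by omega), t.plus_leaves]
    rw [t.plus_leaves]
    exact_mod_cast k.isLt

/-- `t'` arises from `t` by adding one pair of carets. -/
def Step (t t' : TreeTriple d G) : Prop := ∃ k, t' = C.expand t k

/-- Two triples are equivalent if one gets from one to the other by a finite sequence of
expansions and reductions. -/
def tripleSetoid : Setoid (TreeTriple d G) := Relation.EqvGen.setoid C.Step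

/-- The Thompson-like group `𝒯_d(G_*)` of a `d`-ary cloning system, as a set: equivalence classes
`[T₋, g, T₊]` of triples. -/
def Thompson : Type _ := Quotient C.tripleSetoid

/-- The class `[T₋, g, T₊]`. -/
def cls (t : TreeTriple d G) : C.Thompson := Quotient.mk C.tripleSetoid t

/-- `Comp a b c`: `a = (T, g, S)`, `b = (S, h, U)` and `c = (T, g * h, U)`. -/
def Comp (a b c : TreeTriple d G) : Prop :=
  ∃ (n : ℕ) (T S U : DTree d) (g h : G n) (hT : T.numLeaves = n) (hS : S.numLeaves = n)
    (hU : U.numLeaves = n),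
    a = ⟨n, T, g, S, hT, hS⟩ ∧ b = ⟨n, S, h, U, hS, hU⟩ ∧ c = ⟨n, T, g * h, U, hT, hU⟩

/-- The inverse triple `(T₊, g⁻¹, T₋)`. -/
def invTriple (t : TreeTriple d G) : TreeTriple d G :=
  ⟨t.n, t.plus, t.elt⁻¹, t.minus, t.plus_leaves, t.minus_leaves⟩

abbrev Steps (t t' : TreeTriple d G) : Prop := Relation.ReflTransGen C.Step t t'


theorem steps_le {a b : TreeTriple d G} (h : C.Steps a b) : a.plus.le b.plus := by
  induction h with
  | refl => exact DTree.le_refl _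
  | tail _ h ih =>
    obtain ⟨k, rfl⟩ := h
    exact DTree.le_trans ih (DTree.le_addCaret _ _)

theorem steps_eq_of_n {a b : TreeTriple d G} (h : C.Steps a b) (hn : b.n = a.n) : b = a := by
  have le : ∀ {a b : TreeTriple d G}, C.Steps a b → a.n ≤ b.n := by
    intro a b h
    have := DTree.numLeaves_mono C.one_le (C.steps_le h)
    rwa [a.plus_leaves, b.plus_leaves] at this
  rcases Relation.ReflTransGen.cases_head h with h | ⟨c, ⟨k, rfl⟩, h⟩
  · exact h.symm
  · have h1 := le h
    have h2 : (C.expand a k).n = a.n + (d - 1) := rfl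
    have h3 := C.two_le
    omega

/-- Every triple can be expanded so that `T₊` becomes any given larger tree. -/
theorem exists_steps_plus (a : TreeTriple d G) {W : DTree d} (h : a.plus.le W) :
    ∃ b, C.Steps a b ∧ b.plus = W := by
  induction hm : W.numLeaves - a.plus.numLeaves using Nat.strong_induction_on generalizing a with
  | _ m ih =>
    rcases DTree.exists_addCaret_le h with h' | ⟨k, hk, h'⟩
    · exact ⟨a, .refl, h'⟩
    · have hk' : k < a.n := a.plus_leaves ▸ hk
      have h1 := DTree.numLeaves_mono C.one_le h'
      have h2 := DTree.numLeaves_addCaret C.one_le a.plus (k := k) (by omega) (by omega)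
      have h3 := C.two_le
      obtain ⟨b, hb, hW⟩ := ih (W.numLeaves - (C.expand a ⟨k, hk'⟩).plus.numLeaves) (by
        change W.numLeaves - (a.plus.addCaret k).numLeaves < m
        omega) (C.expand a ⟨k, hk'⟩) h' rfl
      exact ⟨b, .head ⟨_, rfl⟩ hb, hW⟩

theorem expand_comm (a : TreeTriple d G) {k l : Fin a.n} (h : k < l) :
    C.expand (C.expand a l) (k.castAdd (d - 1)) = C.expand (C.expand a k) (l.addNat (d - 1)) := by
  have hd := C.one_le
  have hkl : k.val < l.val := h
  have hS : (a.plus.addCaret l.val).addCaret k.val =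
      (a.plus.addCaret k.val).addCaret (l.val + (d - 1 : ℕ)) :=
    DTree.addCaret_comm hd _ (by omega) (by omega) (by rw [a.plus_leaves]; omega)
  refine TreeTriple.mk_congr ?_ (C.κ_κ a.n k l a.elt h) ?_
  · have e1 : C.ρ (a.n + (d - 1)) (C.κ a.n l a.elt) (k.castAdd (d - 1)) =
        standardClone d a.n l (C.ρ a.n a.elt) (k.castAdd (d - 1)) :=
      C.ρ_κ _ _ _ _ (Or.inl hkl)
    have e2 : C.ρ (a.n + (d - 1)) (C.κ a.n k a.elt) (l.addNat (d - 1)) =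
        standardClone d a.n k (C.ρ a.n a.elt) (l.addNat (d - 1)) :=
      C.ρ_κ _ _ _ _ (Or.inr (by simp only [Fin.val_addNat]; omega))
    have s1 : cloneStrand d a.n l (k.castAdd (d - 1)) = k := by
      ext
      simp [cloneStrand, hkl]
    have s2 : cloneStrand d a.n k (l.addNat (d - 1)) = l := by
      ext
      simp only [cloneStrand, Fin.val_addNat]
      split_ifs <;> omega
    have hne : C.ρ a.n a.elt k ≠ C.ρ a.n a.elt l := fun h' => h.ne ((C.ρ a.n a.elt).injective h')
    change (a.minus.addCaret (C.ρ a.n a.elt l).val).addCaret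
        (C.ρ (a.n + (d - 1)) (C.κ a.n l a.elt) (k.castAdd (d - 1))).val =
      (a.minus.addCaret (C.ρ a.n a.elt k).val).addCaret
        (C.ρ (a.n + (d - 1)) (C.κ a.n k a.elt) (l.addNat (d - 1))).val
    rw [e1, e2]
    simp only [standardClone, Equiv.ofBijective_apply, standardCloneFun, s1, s2, if_neg h.ne,
      if_neg h.ne']
    have b1 := (C.ρ a.n a.elt k).isLt
    have b2 := (C.ρ a.n a.elt l).isLt
    rcases lt_or_gt_of_ne hne with hlt | hlt
    · rw [if_pos hlt, if_neg hlt.asymm]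
      have hlt' : (C.ρ a.n a.elt k).val < (C.ρ a.n a.elt l).val := hlt
      have e := DTree.addCaret_comm hd a.minus (k := (C.ρ a.n a.elt k).val)
        (l := (C.ρ a.n a.elt l).val) (by omega) (by omega) (by rw [a.minus_leaves]; omega)
      push_cast at e ⊢
      exact e
    · rw [if_neg hlt.asymm, if_pos hlt]
      have hlt' : (C.ρ a.n a.elt l).val < (C.ρ a.n a.elt k).val := hlt
      have e := DTree.addCaret_comm hd a.minus (k := (C.ρ a.n a.elt l).val)
        (l := (C.ρ a.n a.elt k).val) (by omega) (by omega) (by rw [a.minus_leaves]; omega)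
      push_cast at e ⊢
      exact e.symm
  · change (a.plus.addCaret l.val).addCaret ((k.castAdd (d - 1)).val : ℕ) =
      (a.plus.addCaret k.val).addCaret ((l.addNat (d - 1)).val : ℕ)
    simpa using hS

/-- The result of expanding a triple only depends on the resulting tree `T₊`. -/
theorem steps_unique {a b c : TreeTriple d G} (hb : C.Steps a b) (hc : C.Steps a c)
    (h : b.plus = c.plus) : b = c := by
  induction hm : b.n - a.n using Nat.strong_induction_on generalizing a b c with
  | _ m ih =>
    have hn : b.n = c.n := by rw [← b.plus_leaves, ← c.plus_leaves, h]
    rcases Relation.ReflTransGen.cases_head hb with rfl | ⟨b', ⟨k, rfl⟩, hb'⟩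
    · exact (C.steps_eq_of_n hc hn.symm).symm
    rcases Relation.ReflTransGen.cases_head hc with rfl | ⟨c', ⟨l, rfl⟩, hc'⟩
    · exact C.steps_eq_of_n hb hn
    have key : ∀ (e : TreeTriple d G) (i : Fin a.n), C.Steps (C.expand a i) e → b.n = e.n →
        b.n - (C.expand a i).n < m := by
      intro e i he hne
      have h1 := DTree.numLeaves_mono C.one_le (C.steps_le he)
      rw [TreeTriple.plus_leaves, TreeTriple.plus_leaves] at h1
      have h2 : (C.expand a i).n = a.n + (d - 1) := rfl
      have h3 := C.two_le
      omega
    have main : ∀ (k l : Fin a.n) (b c : TreeTriple d G), C.Steps (C.expand a k) b →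
        C.Steps (C.expand a l) c → b.plus = c.plus → b.n - (C.expand a k).n < m →
        c.n - (C.expand a l).n < m → k < l → b = c := by
      intro k l b c hb hc h mb mc hkl
      have hle : ((a.plus.addCaret l.val).addCaret k.val).le b.plus :=
        DTree.addCaret_le_of_le C.one_le (by exact_mod_cast hkl) (C.steps_le hb)
          (h ▸ C.steps_le hc)
      obtain ⟨e, he, hW⟩ := C.exists_steps_plus
        (C.expand (C.expand a l) (k.castAdd (d - 1))) (W := b.plus) hle
      have he1 : C.Steps (C.expand a l) e := .head ⟨_, rfl⟩ he
      have he2 : C.Steps (C.expand a k) e := by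
        rw [C.expand_comm a hkl] at he
        exact .head ⟨_, rfl⟩ he
      exact (ih _ mb hb he2 hW.symm rfl).trans (ih _ mc hc he1 (h.symm.trans hW.symm) rfl).symm
    rcases lt_trichotomy k l with hkl | hkl | hkl
    · exact main k l b c hb' hc' h (key b k hb' rfl) (hn ▸ key c l hc' hn) hkl
    · subst hkl
      exact ih _ (key b k hb' rfl) hb' hc' h rfl
    · exact (main l k c b hc' hb' h.symm (hn ▸ key c l hc' hn) (key b k hb' rfl) hkl).symm

theorem steps_join {a b c : TreeTriple d G} (hb : C.Steps a b) (hc : C.Steps a c) :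
    ∃ e, C.Steps b e ∧ C.Steps c e := by
  obtain ⟨b', hb', e1⟩ := C.exists_steps_plus b (DTree.le_sup_left b.plus c.plus)
  obtain ⟨c', hc', e2⟩ := C.exists_steps_plus c (DTree.le_sup_right b.plus c.plus)
  have : b' = c' := C.steps_unique (hb.trans hb') (hc.trans hc') (e1.trans e2.symm)
  exact ⟨b', hb', this ▸ hc'⟩

theorem cls_eq_of_steps {a b : TreeTriple d G} (h : C.Steps a b) : C.cls a = C.cls b :=
  Quotient.sound (s := C.tripleSetoid) (by
    induction h with
    | refl => exact Relation.EqvGen.refl _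
    | tail _ h ih => exact ih.trans _ _ _ (Relation.EqvGen.rel _ _ h))

/-- Equivalent triples have a common expansion. -/
theorem cls_eq_iff {a b : TreeTriple d G} :
    C.cls a = C.cls b ↔ ∃ e, C.Steps a e ∧ C.Steps b e := by
  constructor
  · intro h
    have h' : Relation.EqvGen C.Step a b := Quotient.exact h
    clear h
    induction h' with
    | rel a b h => exact ⟨b, .single h, .refl⟩
    | refl a => exact ⟨a, .refl, .refl⟩
    | symm a b _ ih =>
      obtain ⟨e, h1, h2⟩ := ih
      exact ⟨e, h2, h1⟩
    | trans a b c _ _ ih1 ih2 =>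
      obtain ⟨e, h1, h2⟩ := ih1
      obtain ⟨f, h3, h4⟩ := ih2
      obtain ⟨g, h5, h6⟩ := C.steps_join h2 h3
      exact ⟨g, h1.trans h5, h4.trans h6⟩
  · rintro ⟨e, h1, h2⟩
    exact (C.cls_eq_of_steps h1).trans (C.cls_eq_of_steps h2).symm

theorem inv_expand (a : TreeTriple d G) (k : Fin a.n) :
    invTriple (C.expand a k) = C.expand (invTriple a) (C.ρ a.n a.elt k) := by
  refine TreeTriple.mk_congr ?_ ?_ rfl
  · change a.plus.addCaret k.val = a.plus.addCaret (C.ρ a.n a.elt⁻¹ (C.ρ a.n a.elt k)).val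
    simp
  · change (C.κ a.n k a.elt)⁻¹ = C.κ a.n (C.ρ a.n a.elt k) a.elt⁻¹
    rw [inv_eq_iff_mul_eq_one.2]
    have h := C.κ_mul a.n (C.ρ a.n a.elt k) a.elt a.elt⁻¹
    simpa [C.κ_one] using h.symm

theorem inv_inv_triple (a : TreeTriple d G) : invTriple (invTriple a) = a := by
  refine TreeTriple.mk_congr rfl ?_ rfl
  exact inv_inv a.elt

theorem steps_inv {a b : TreeTriple d G} (h : C.Steps a b) :
    C.Steps (invTriple a) (invTriple b) := by
  induction h with
  | refl => exact .refl
  | tail _ h ih =>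
    obtain ⟨k, rfl⟩ := h
    exact ih.tail ⟨_, C.inv_expand _ k⟩

theorem exists_steps_minus (a : TreeTriple d G) {W : DTree d} (h : a.minus.le W) :
    ∃ b, C.Steps a b ∧ b.minus = W := by
  obtain ⟨b, hb, hW⟩ := C.exists_steps_plus (invTriple a) h
  refine ⟨invTriple b, ?_, hW⟩
  have := C.steps_inv hb
  rwa [inv_inv_triple] at this

theorem Comp.unique {a b c c' : TreeTriple d G} (h : Comp a b c) (h' : Comp a b c') : c = c' := by
  obtain ⟨n, T, S, U, g, h, hT, hS, hU, rfl, rfl, rfl⟩ := h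
  obtain ⟨n, T, S, U, g, h, hT, hS, hU, e1, e2, rfl⟩ := h'
  injection e1 with a1 a2 a3 a4
  subst a1
  injection e2 with b1 b2 b3 b4
  subst a2 b4
  obtain rfl := eq_of_heq a3
  subst b3
  rfl

theorem exists_comp {a b : TreeTriple d G} (h : a.plus = b.minus) : ∃ c, Comp a b c := by
  obtain ⟨n, T, g, S, hT, hS⟩ := a
  obtain ⟨m, S', h, U, hS', hU⟩ := b
  simp only at h
  subst h
  have : m = n := hS'.symm.trans hS
  subst this
  exact ⟨_, m, T, S, U, g, h, hT, hS, hU, rfl, rfl, rfl⟩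

theorem Comp.inv {a b c : TreeTriple d G} (h : Comp a b c) :
    Comp (invTriple b) (invTriple a) (invTriple c) := by
  obtain ⟨n, T, S, U, g, h, hT, hS, hU, rfl, rfl, rfl⟩ := h
  refine ⟨n, U, S, T, h⁻¹, g⁻¹, hU, hS, hT, rfl, rfl, ?_⟩
  exact TreeTriple.mk_congr rfl (mul_inv_rev g h) rfl

theorem Comp.steps_right {a b c b' : TreeTriple d G} (h : Comp a b c) (hb : C.Steps b b') :
    ∃ a' c', C.Steps a a' ∧ C.Steps c c' ∧ Comp a' b' c' := by
  induction hb with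
  | refl => exact ⟨a, c, .refl, .refl, h⟩
  | tail _ hs ih =>
    obtain ⟨a', c', ha, hc, hcomp⟩ := ih
    obtain ⟨k, rfl⟩ := hs
    obtain ⟨n, T, S, U, g, h, hT, hS, hU, rfl, rfl, rfl⟩ := hcomp
    refine ⟨_, _, ha.tail ⟨C.ρ n h k, rfl⟩, hc.tail ⟨k, rfl⟩, n + (d - 1), T.addCaret
      (C.ρ n (g * h) k).val, S.addCaret (C.ρ n h k).val, U.addCaret k.val,
      C.κ n (C.ρ n h k) g, C.κ n k h, (C.expand ⟨n, T, g * h, U, hT, hU⟩ k).minus_leaves,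
      (C.expand ⟨n, S, h, U, hS, hU⟩ k).minus_leaves,
      (C.expand ⟨n, S, h, U, hS, hU⟩ k).plus_leaves, ?_, rfl, ?_⟩
    · refine TreeTriple.mk_congr ?_ rfl rfl
      simp
    · exact TreeTriple.mk_congr rfl (C.κ_mul n k g h) rfl

theorem Comp.steps_left {a b c a' : TreeTriple d G} (h : Comp a b c) (ha : C.Steps a a') :
    ∃ b' c', C.Steps b b' ∧ C.Steps c c' ∧ Comp a' b' c' := by
  obtain ⟨b', c', hb, hc, hcomp⟩ := h.inv.steps_right C (C.steps_inv ha)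
  refine ⟨invTriple b', invTriple c', ?_, ?_, ?_⟩
  · simpa only [inv_inv_triple] using C.steps_inv hb
  · simpa only [inv_inv_triple] using C.steps_inv hc
  · simpa only [inv_inv_triple] using hcomp.inv

theorem exists_prod (x y : C.Thompson) :
    ∃ z, ∃ a b c, Comp a b c ∧ C.cls a = x ∧ C.cls b = y ∧ C.cls c = z := by
  obtain ⟨a, rfl⟩ := Quotient.exists_rep x
  obtain ⟨b, rfl⟩ := Quotient.exists_rep y
  obtain ⟨a', ha, h1⟩ := C.exists_steps_plus a (DTree.le_sup_left a.plus b.minus)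
  obtain ⟨b', hb, h2⟩ := C.exists_steps_minus b (DTree.le_sup_right a.plus b.minus)
  obtain ⟨c, hc⟩ := exists_comp (h1.trans h2.symm)
  exact ⟨C.cls c, a', b', c, hc, (C.cls_eq_of_steps ha).symm, (C.cls_eq_of_steps hb).symm, rfl⟩

theorem prod_unique {a b c a' b' c' : TreeTriple d G} (h : Comp a b c) (h' : Comp a' b' c')
    (ha : C.cls a = C.cls a') (hb : C.cls b = C.cls b') : C.cls c = C.cls c' := by
  obtain ⟨α, h1, h2⟩ := C.cls_eq_iff.1 ha
  obtain ⟨β, γ, hβ, hγ, hcomp⟩ := h.steps_left C h1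
  obtain ⟨β', γ', hβ', hγ', hcomp'⟩ := h'.steps_left C h2
  have hββ : C.cls β = C.cls β' :=
    ((C.cls_eq_of_steps hβ).symm.trans hb).trans (C.cls_eq_of_steps hβ')
  obtain ⟨δ, h3, h4⟩ := C.cls_eq_iff.1 hββ
  obtain ⟨ε, ζ, hε, hζ, hcomp2⟩ := hcomp.steps_right C h3
  obtain ⟨ε', ζ', hε', hζ', hcomp2'⟩ := hcomp'.steps_right C h4
  have comp_eq : ∀ {a b c : TreeTriple d G}, Comp a b c → a.plus = b.minus := by
    rintro a b c ⟨n, T, S, U, g, h, hT, hS, hU, rfl, rfl, rfl⟩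
    rfl
  have : ε = ε' := C.steps_unique hε hε' ((comp_eq hcomp2).trans (comp_eq hcomp2').symm)
  subst this
  have := hcomp2.unique hcomp2'
  subst this
  rw [C.cls_eq_of_steps hγ, C.cls_eq_of_steps hζ, C.cls_eq_of_steps hγ', C.cls_eq_of_steps hζ']

/-- `[T, g, S] [S, h, U] = [T, g * h, U]`. -/
noncomputable instance : Mul C.Thompson := ⟨fun x y => (C.exists_prod x y).choose⟩

/-- The identity `[T, 1, T]`, with `T` the trivial tree. -/
instance : One C.Thompson := ⟨C.cls ⟨1, .leaf, 1, .leaf, rfl, rfl⟩⟩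

/-- `[T₋, g, T₊]⁻¹ = [T₊, g⁻¹, T₋]`. -/
instance : Inv C.Thompson := ⟨Quotient.lift (fun t => C.cls (invTriple t)) (by
  intro a b h
  obtain ⟨e, h1, h2⟩ := C.cls_eq_iff.1 (Quotient.sound h)
  exact C.cls_eq_iff.2 ⟨_, C.steps_inv h1, C.steps_inv h2⟩)⟩

theorem Comp.cls_mul {a b c : TreeTriple d G} (h : Comp a b c) : C.cls a * C.cls b = C.cls c := by
  obtain ⟨a', b', c', h', h1, h2, h3⟩ := (C.exists_prod (C.cls a) (C.cls b)).choose_spec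
  exact h3.symm.trans (C.prod_unique h' h h1 h2)

theorem cls_mul_cls {n : ℕ} {T S U : DTree d} (g h : G n) (hT : T.numLeaves = n)
    (hS : S.numLeaves = n) (hU : U.numLeaves = n) :
    C.cls ⟨n, T, g, S, hT, hS⟩ * C.cls ⟨n, S, h, U, hS, hU⟩ =
      C.cls ⟨n, T, g * h, U, hT, hU⟩ :=
  Comp.cls_mul C ⟨n, T, S, U, g, h, hT, hS, hU, rfl, rfl, rfl⟩

theorem cls_inv {n : ℕ} {T S : DTree d} (g : G n) (hT : T.numLeaves = n) (hS : S.numLeaves = n) :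
    (C.cls ⟨n, T, g, S, hT, hS⟩)⁻¹ = C.cls ⟨n, S, g⁻¹, T, hS, hT⟩ :=
  rfl

/-- The identity is `[T, 1, T]` for any tree `T`. -/
theorem one_eq_cls {n : ℕ} {T : DTree d} (hT : T.numLeaves = n) :
    (1 : C.Thompson) = C.cls ⟨n, T, 1, T, hT, hT⟩ := by
  have key : ∀ a b : TreeTriple d G, C.Steps a b → a.minus = a.plus ∧ a.elt = 1 →
      b.minus = b.plus ∧ b.elt = 1 := by
    intro a b h ha
    induction h with
    | refl => exact ha
    | tail _ h ih =>
      obtain ⟨k, rfl⟩ := h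
      simp [expand, ih.1, ih.2, C.κ_one]
      rfl
  obtain ⟨b, hb, hW⟩ := C.exists_steps_plus ⟨1, .leaf, 1, .leaf, rfl, rfl⟩ (W := T) trivial
  refine (C.cls_eq_of_steps hb).trans ?_
  have := key _ _ hb ⟨rfl, rfl⟩
  obtain ⟨m, S, g, S', h1, h2⟩ := b
  have hS : S = S' := this.1
  have hg : g = 1 := this.2
  simp only at hW
  subst hS hg hW
  have : m = n := h1.symm.trans hT
  subst this
  rfl

theorem cls_surjective (x : C.Thompson) : ∃ t, C.cls t = x := Quotient.exists_rep x

/-- The Thompson-like group `𝒯_d(G_*)` of a `d`-ary cloning system. -/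
noncomputable instance : Group C.Thompson := Group.ofLeftAxioms
  (by
    intro x y z
    obtain ⟨p, a, b, c, h, rfl, rfl, rfl⟩ := C.exists_prod x y
    obtain ⟨e, rfl⟩ := C.cls_surjective z
    obtain ⟨b1, hb, h1⟩ := C.exists_steps_plus b (DTree.le_sup_left b.plus e.minus)
    obtain ⟨e1, he, h2⟩ := C.exists_steps_minus e (DTree.le_sup_right b.plus e.minus)
    obtain ⟨a1, c1, ha, hc, hcomp⟩ := h.steps_right C hb
    rw [C.cls_eq_of_steps ha, C.cls_eq_of_steps hb, C.cls_eq_of_steps he]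
    obtain ⟨n, T, S, U, g, h, hT, hS, hU, rfl, rfl, rfl⟩ := hcomp
    obtain ⟨m, U', f, V, hU', hV⟩ := e1
    have : U' = U := h2.trans h1.symm
    subst this
    have : m = n := hU'.symm.trans hU
    subst this
    simp only [cls_mul_cls, mul_assoc])
  (by
    intro x
    obtain ⟨⟨n, T, g, S, hT, hS⟩, rfl⟩ := C.cls_surjective x
    rw [C.one_eq_cls hT, cls_mul_cls, one_mul])
  (by
    intro x
    obtain ⟨⟨n, T, g, S, hT, hS⟩, rfl⟩ := C.cls_surjective x
    rw [cls_inv, cls_mul_cls, inv_mul_cancel, ← C.one_eq_cls])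

end CloningSystem

/-- A group is ICC if the conjugacy class of every non-trivial element is infinite. -/
def IsICC (Γ : Type*) [Group Γ] : Prop :=
  ∀ g : Γ, g ≠ 1 → (conjugatesOf g).Infinite

/-- The Hilbert space `ℓ²(Γ)`. -/
abbrev EllTwo (Γ : Type*) : Type _ := lp (fun _ : Γ => ℂ) 2

theorem EllTwo.memℓp_comp {Γ : Type*} (e : Γ ≃ Γ) (f : EllTwo Γ) :
    Memℓp (fun x => f (e x)) 2 := by
  have h := lp.memℓp f
  rw [memℓp_gen_iff (by norm_num)] at h ⊢
  exact (e.summable_iff (f := fun x => ‖f x‖ ^ (2 : ENNReal).toReal)).2 h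

/-- Left translation by `g` on `ℓ²(Γ)`: `(g ψ)(x) = ψ(g⁻¹ x)`. -/
noncomputable def leftTranslation {Γ : Type*} [Group Γ] (g : Γ) : EllTwo Γ →ₗᵢ[ℂ] EllTwo Γ where
  toFun f := ⟨fun x => f (g⁻¹ * x), EllTwo.memℓp_comp (Equiv.mulLeft g⁻¹) f⟩
  map_add' _ _ := rfl
  map_smul' _ _ := rfl
  norm_map' f := by
    have h : (0 : ℝ) < (2 : ENNReal).toReal := by norm_num
    rw [lp.norm_eq_tsum_rpow h, lp.norm_eq_tsum_rpow h]
    congr 1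
    exact (Equiv.mulLeft g⁻¹).tsum_eq (fun x => ‖f x‖ ^ (2 : ENNReal).toReal)

/-- The algebra `B(H)` of bounded operators on a Hilbert space `H`, with the weak operator
topology. -/
abbrev BoundedOps (H : Type*) [NormedAddCommGroup H] [InnerProductSpace ℂ H] : Type _ := H →WOT[ℂ] H

/-- The action of `Γ` on `ℓ²(Γ)` by left translations. -/
noncomputable def leftRegular (Γ : Type*) [Group Γ] : Γ →* BoundedOps (EllTwo Γ) where
  toFun g := .ofCLM (leftTranslation g).toContinuousLinearMap
  map_one' := by
    refine ContinuousLinearMapWOT.ext fun f => lp.ext (funext fun x => ?_)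
    change f (1⁻¹ * x) = f x
    simp
  map_mul' g h := by
    refine ContinuousLinearMapWOT.ext fun f => lp.ext (funext fun x => ?_)
    change f ((g * h)⁻¹ * x) = f (h⁻¹ * (g⁻¹ * x))
    simp [mul_assoc]

theorem star_leftRegular {Γ : Type*} [Group Γ] (g : Γ) :
    star (leftRegular Γ g) = leftRegular Γ g⁻¹ := by
  refine ContinuousLinearMapWOT.toCLM_injective ?_
  change ContinuousLinearMap.adjoint (leftRegular Γ g).toCLM = (leftRegular Γ g⁻¹).toCLM
  symm
  rw [ContinuousLinearMap.eq_adjoint_iff]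
  intro f f'
  have h : leftRegular Γ g (leftRegular Γ g⁻¹ f) = f := by
    rw [← ContinuousLinearMapWOT.mul_apply, ← map_mul, mul_inv_cancel, map_one,
      ContinuousLinearMapWOT.one_apply]
  conv_rhs => rw [← h]
  exact ((leftTranslation g).inner_map_map _ _).symm

/-- The complex group algebra `ℂ[Γ]` as an algebra of bounded operators on `ℓ²(Γ)`: the finite
linear combinations of left translations. -/
noncomputable def groupAlgebraOps (Γ : Type*) [Group Γ] :
    StarSubalgebra ℂ (BoundedOps (EllTwo Γ)) where
  toSubalgebra := (MonoidAlgebra.lift ℂ (BoundedOps (EllTwo Γ)) Γ (leftRegular Γ)).range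
  star_mem' := by
    have key : ∀ x, star (MonoidAlgebra.lift ℂ (BoundedOps (EllTwo Γ)) Γ (leftRegular Γ) x) ∈
        (MonoidAlgebra.lift ℂ (BoundedOps (EllTwo Γ)) Γ (leftRegular Γ)).range := by
      intro x
      induction x using MonoidAlgebra.induction_on with
      | of g => exact ⟨MonoidAlgebra.of ℂ Γ g⁻¹, by simp [star_leftRegular]⟩
      | add x y hx hy =>
        rw [map_add, star_add]
        exact add_mem hx hy
      | smul c x hx =>
        rw [map_smul, star_smul]
        exact Subalgebra.smul_mem _ hx _
    rintro _ ⟨x, rfl⟩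
    exact key x

/-- The group von Neumann algebra `L(Γ)`: the closure of `ℂ[Γ]` in `B(ℓ²(Γ))` with respect to the
weak operator topology. -/
noncomputable def groupVonNeumannAlgebra (Γ : Type*) [Group Γ] :
    StarSubalgebra ℂ (BoundedOps (EllTwo Γ)) :=
  (groupAlgebraOps Γ).topologicalClosure

section VonNeumann

variable {H : Type*} [NormedAddCommGroup H] [InnerProductSpace ℂ H] [CompleteSpace H]

/-- A von Neumann algebra on `H` is a `*`-subalgebra of `B(H)` which is closed in the weak operator
topology. -/
def IsVonNeumannAlgebra (M : StarSubalgebra ℂ (BoundedOps H)) : Prop :=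
  IsClosed (M : Set (BoundedOps H))

/-- A von Neumann algebra is a factor if its center is trivial, that is, consists only of the scalar
multiples of the identity operator. -/
def IsFactor (M : StarSubalgebra ℂ (BoundedOps H)) : Prop :=
  IsVonNeumannAlgebra M ∧
    ∀ x ∈ M, (∀ y ∈ M, x * y = y * x) → ∃ c : ℂ, x = c • (1 : BoundedOps H)

/-- A trace state: a positive linear functional `τ` with `τ 1 = 1` and `τ (x y) = τ (y x)`. -/
structure IsTraceState (M : StarSubalgebra ℂ (BoundedOps H)) (τ : M →ₗ[ℂ] ℂ) : Prop where
  map_one : τ 1 = 1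
  map_mul_comm : ∀ x y, τ (x * y) = τ (y * x)
  nonneg_re : ∀ x, 0 ≤ (τ (star x * x)).re
  im_eq_zero : ∀ x, (τ (star x * x)).im = 0

/-- A factor is of type II₁ if it is infinite dimensional and admits a trace state. -/
def IsTypeIIOneFactor (M : StarSubalgebra ℂ (BoundedOps H)) : Prop :=
  IsFactor M ∧ ¬ FiniteDimensional ℂ M ∧ ∃ τ : M →ₗ[ℂ] ℂ, IsTraceState M τ

end VonNeumann

/-! Under full compatibility, `[T₋, g, T₊]` acts on infinite words over `Fin d`: the part of a word
that leads to leaf `k` of `T₊` is replaced by the path to leaf `ρ(g)(k)` of `T₋`. An element acts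
trivially exactly when `T₋ = T₊` and `ρ(g) = 1` in any representative.

If `x` moves some word `w` to a word `y` lying below a different leaf of a tree `S`, there are
elements `f_a` supported below the leaf of `w` that carry `w` to infinitely many distinct words
`v_a` and fix `y`. The conjugate of `x` by `f_a` sends `v_a` to `y`, so these conjugates are
pairwise distinct (`infinite_conjugatesOf_of_not_actsTrivially`).

If `x` acts trivially and has finitely many conjugates, all of them can be written `[W, g, W]` with
one large tree `W`, and then `[W_k, (g)κ_k, W_k]`, where `W_k` is `W` with a caret at leaf `k`.
Conjugation by `[W_k, 1, W_0]` moves the same group element from `W_0` to `W_k`, so the element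
attached to `x` over `W_0` lies in the image of every `κ_k`. Diversity makes it trivial
(`eq_one_of_actsTrivially_of_finite`).

The factor statement is the classical one for infinite ICC groups: for central `A`, the
square-summable function `A δ₁` is constant on conjugacy classes, hence a multiple of `δ₁`
(`exists_eq_smul_one_of_isICC`), and `A ↦ ⟨δ₁, A δ₁⟩` is a trace state. -/

/-! ### The standard orthonormal basis of `ℓ²(Γ)` and matrix coefficients. -/

namespace EllTwo

open scoped ComplexConjugate

variable {Γ : Type*}

open Classical in
/-- The vector `δ_g` of the standard orthonormal basis of `ℓ²(Γ)`. -/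
noncomputable def delta (g : Γ) : EllTwo Γ := lp.single 2 g (1 : ℂ)

theorem delta_self (g : Γ) : delta g g = 1 := by
  classical
  simp [delta, lp.single_apply]

theorem delta_of_ne {g h : Γ} (H : h ≠ g) : delta g h = 0 := by
  classical
  simp [delta, lp.single_apply, H]

theorem inner_delta_left (g : Γ) (f : EllTwo Γ) : inner ℂ (delta g) f = f g := by
  classical
  simpa [delta] using lp.inner_single_left (𝕜 := ℂ) g (1 : ℂ) f

theorem inner_delta_right (g : Γ) (f : EllTwo Γ) : inner ℂ f (delta g) = conj (f g) := by
  rw [← inner_delta_left, inner_conj_symm]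

theorem inner_star_apply (A : BoundedOps (EllTwo Γ)) (x y : EllTwo Γ) :
    inner ℂ (star A x) y = inner ℂ x (A y) := by
  rw [ContinuousLinearMapWOT.star_apply, ContinuousLinearMap.star_eq_adjoint,
    ContinuousLinearMap.adjoint_inner_left]
  rfl

theorem star_apply_delta (A : BoundedOps (EllTwo Γ)) (g h : Γ) :
    star A (delta h) g = conj (A (delta g) h) := by
  rw [← inner_delta_left g, ← inner_star_apply, star_star, inner_delta_right]

theorem linearIndependent_delta : LinearIndependent ℂ (delta : Γ → EllTwo Γ) := by
  have h : Orthonormal ℂ (delta : Γ → EllTwo Γ) := by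
    classical
    rw [orthonormal_iff_ite]
    intro g h
    rw [inner_delta_left]
    split_ifs with H
    · rw [H, delta_self]
    · exact delta_of_ne H
  exact h.linearIndependent

/-- A square-summable function which is constant on an infinite set vanishes there. -/
theorem eq_zero_of_infinite (f : EllTwo Γ) {s : Set Γ} (hs : s.Infinite) {c : ℂ}
    (h : ∀ x ∈ s, f x = c) : c = 0 := by
  by_contra hc
  have h2 : (0 : ℝ) < (2 : ENNReal).toReal := by norm_num
  have hsum := (lp.memℓp f).summable h2
  have hpos : (0 : ℝ) < ‖c‖ ^ (2 : ENNReal).toReal :=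
    Real.rpow_pos_of_pos (norm_pos_iff.2 hc) _
  have hev := hsum.tendsto_cofinite_zero.eventually_lt_const hpos
  refine hs (Set.Finite.subset hev fun x hx => ?_)
  simp [h x hx]

variable [Group Γ]

theorem leftRegular_apply (g : Γ) (f : EllTwo Γ) (x : Γ) :
    leftRegular Γ g f x = f (g⁻¹ * x) := rfl

theorem leftRegular_delta (g h : Γ) : leftRegular Γ g (delta h) = delta (g * h) := by
  refine lp.ext (funext fun x => ?_)
  rw [leftRegular_apply]
  by_cases H : x = g * h
  · rw [H, delta_self, inv_mul_cancel_left, delta_self]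
  · rw [delta_of_ne H, delta_of_ne]
    rintro rfl
    simp at H

end EllTwo

/-! ### The group von Neumann algebra of an ICC group. -/

section GroupVonNeumannAlgebra

open EllTwo
open scoped ComplexConjugate

variable {Γ : Type*} [Group Γ]

theorem leftRegular_mem (g : Γ) : leftRegular Γ g ∈ groupVonNeumannAlgebra Γ :=
  StarSubalgebra.le_topologicalClosure _ ⟨MonoidAlgebra.of ℂ Γ g, by simp⟩

/-- The operators in `L(Γ)` commute with right translations. -/
theorem apply_delta_of_mem {A : BoundedOps (EllTwo Γ)} (hA : A ∈ groupVonNeumannAlgebra Γ)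
    (g h : Γ) : A (delta h) g = A (delta 1) (g * h⁻¹) := by
  -- An equation between two matrix coefficients is closed in the weak operator topology, so it
  -- suffices to check it on `ℂ[Γ]`.
  have hclosed : IsClosed {A : BoundedOps (EllTwo Γ) |
      inner ℂ (delta g) (A (delta h)) = inner ℂ (delta (g * h⁻¹)) (A (delta 1))} :=
    isClosed_eq (ContinuousLinearMapWOT.continuous_inner_apply continuous_id _ _)
      (ContinuousLinearMapWOT.continuous_inner_apply continuous_id _ _)
  have hsub : (groupAlgebraOps Γ : Set (BoundedOps (EllTwo Γ))) ⊆ {A : BoundedOps (EllTwo Γ) |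
      inner ℂ (delta g) (A (delta h)) = inner ℂ (delta (g * h⁻¹)) (A (delta 1))} := by
    rintro _ ⟨x, rfl⟩
    simp only [Set.mem_ofPred_eq, inner_delta_left]
    induction x using MonoidAlgebra.induction_on with
    | of a =>
      change MonoidAlgebra.lift ℂ _ Γ (leftRegular Γ) (MonoidAlgebra.of ℂ Γ a) (delta h) g =
        MonoidAlgebra.lift ℂ _ Γ (leftRegular Γ) (MonoidAlgebra.of ℂ Γ a) (delta 1) (g * h⁻¹)
      rw [MonoidAlgebra.lift_of, leftRegular_delta, leftRegular_delta, mul_one]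
      by_cases H : g = a * h
      · rw [H, delta_self, mul_inv_cancel_right, delta_self]
      · rw [delta_of_ne H, delta_of_ne]
        rintro rfl
        simp at H
    | add x y hx hy =>
      rw [map_add]
      exact congrArg₂ (· + ·) hx hy
    | smul c x hx =>
      change MonoidAlgebra.lift ℂ _ Γ (leftRegular Γ) (c • x) (delta h) g =
        MonoidAlgebra.lift ℂ _ Γ (leftRegular Γ) (c • x) (delta 1) (g * h⁻¹)
      rw [map_smul]
      exact congrArg (c • ·) hx
  have := closure_minimal hsub hclosed hA
  simpa only [Set.mem_ofPred_eq, inner_delta_left] using this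

/-- The value is `⟨A* δ₁, B δ₁⟩`; translation invariance of `A` turns its row at `1` into its column
at `1`. The resulting convolution sum is symmetric under `g ↦ g⁻¹`, which yields the trace property.
-/
theorem mul_apply_delta_one {A : BoundedOps (EllTwo Γ)} (hA : A ∈ groupVonNeumannAlgebra Γ)
    (B : BoundedOps (EllTwo Γ)) :
    (A * B) (delta 1) 1 = ∑' g, A (delta 1) g⁻¹ * B (delta 1) g := by
  rw [← inner_delta_left, ContinuousLinearMapWOT.mul_apply, ← inner_star_apply,
    lp.inner_eq_tsum]
  refine tsum_congr fun g => ?_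
  rw [star_apply_delta, apply_delta_of_mem hA, one_mul]
  simp [mul_comm]

theorem apply_delta_one_mul_comm {A B : BoundedOps (EllTwo Γ)}
    (hA : A ∈ groupVonNeumannAlgebra Γ) (hB : B ∈ groupVonNeumannAlgebra Γ) :
    (A * B) (delta 1) 1 = (B * A) (delta 1) 1 := by
  rw [mul_apply_delta_one hA, mul_apply_delta_one hB, ← (Equiv.inv Γ).tsum_eq]
  exact tsum_congr fun g => by simp [mul_comm]

/-- The trace `A ↦ ⟨δ₁, A δ₁⟩` on `L(Γ)`. -/
noncomputable def canonicalTrace (Γ : Type*) [Group Γ] : groupVonNeumannAlgebra Γ →ₗ[ℂ] ℂ where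
  toFun A := (A : BoundedOps (EllTwo Γ)) (delta 1) 1
  map_add' _ _ := rfl
  map_smul' _ _ := rfl

theorem isTraceState_canonicalTrace (Γ : Type*) [Group Γ] :
    IsTraceState (groupVonNeumannAlgebra Γ) (canonicalTrace Γ) := by
  -- The trace of `x* x` is `‖x δ₁‖²`.
  have key : ∀ x : groupVonNeumannAlgebra Γ, canonicalTrace Γ (star x * x) =
      inner ℂ ((x : BoundedOps (EllTwo Γ)) (delta 1)) ((x : BoundedOps (EllTwo Γ)) (delta 1)) := by
    intro x
    change (star (x : BoundedOps (EllTwo Γ)) * (x : BoundedOps (EllTwo Γ))) (delta 1) 1 = _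
    rw [← inner_delta_left, ContinuousLinearMapWOT.mul_apply, ← inner_star_apply, star_star]
  refine ⟨delta_self 1, fun x y => apply_delta_one_mul_comm x.2 y.2, fun x => ?_, fun x => ?_⟩
  · rw [key]
    exact inner_self_nonneg (𝕜 := ℂ)
  · rw [key]
    exact inner_self_im (𝕜 := ℂ) _

theorem not_finiteDimensional_groupVonNeumannAlgebra [Infinite Γ] :
    ¬ FiniteDimensional ℂ (groupVonNeumannAlgebra Γ) := by
  intro hfin
  -- Evaluation at `δ₁` maps the left translations to the orthonormal family `delta`.
  let ev : groupVonNeumannAlgebra Γ →ₗ[ℂ] EllTwo Γ :=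
    { toFun := fun A => (A : BoundedOps (EllTwo Γ)) (delta 1)
      map_add' := fun _ _ => rfl
      map_smul' := fun _ _ => rfl }
  have hli : LinearIndependent ℂ
      (fun g : Γ => (⟨leftRegular Γ g, leftRegular_mem g⟩ : groupVonNeumannAlgebra Γ)) := by
    refine LinearIndependent.of_comp ev ?_
    have h : (ev ∘ fun g : Γ => (⟨leftRegular Γ g, leftRegular_mem g⟩ : groupVonNeumannAlgebra Γ)) =
        delta := funext fun g => (leftRegular_delta g 1).trans (by rw [mul_one])
    rw [h]
    exact linearIndependent_delta
  have := hli.finite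
  exact not_finite Γ

/-- The central elements of `L(Γ)` are scalar if `Γ` is ICC. -/
theorem exists_eq_smul_one_of_isICC (hΓ : IsICC Γ) {A : BoundedOps (EllTwo Γ)}
    (hA : A ∈ groupVonNeumannAlgebra Γ) (hc : ∀ g, A * leftRegular Γ g = leftRegular Γ g * A) :
    ∃ c : ℂ, A = c • (1 : BoundedOps (EllTwo Γ)) := by
  -- `A` commutes with left translations by centrality and with right translations by membership in
  -- `L(Γ)`, so `A δ₁` is a class function.
  have hconj : ∀ g y : Γ, A (delta 1) (g * y * g⁻¹) = A (delta 1) y := by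
    intro g y
    have h1 : A (delta g) = leftRegular Γ g (A (delta 1)) := by
      have := congrArg (fun B : BoundedOps (EllTwo Γ) => B (delta 1)) (hc g)
      simpa only [ContinuousLinearMapWOT.mul_apply, leftRegular_delta, mul_one] using this
    rw [← apply_delta_of_mem hA, h1, leftRegular_apply, inv_mul_cancel_left]
  have hzero : ∀ y : Γ, y ≠ 1 → A (delta 1) y = 0 := by
    intro y hy
    refine eq_zero_of_infinite (A (delta 1)) (hΓ y hy) fun x hx => ?_
    obtain ⟨g, rfl⟩ := isConj_iff.1 hx
    exact hconj g y
  have hdelta : ∀ g h : Γ, A (delta h) g = A (delta 1) 1 * delta h g := by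
    intro g h
    rw [apply_delta_of_mem hA]
    by_cases H : g = h
    · rw [H, mul_inv_cancel, delta_self, mul_one]
    · rw [delta_of_ne H, mul_zero, hzero _ (by rwa [Ne, mul_inv_eq_one])]
  refine ⟨A (delta 1) 1, ContinuousLinearMapWOT.ext fun f => lp.ext (funext fun g => ?_)⟩
  -- Knowing the adjoint on basis vectors determines every coordinate `⟨δ_g, A f⟩ = ⟨A* δ_g, f⟩`, so
  -- no density argument is needed.
  have hstar : star A (delta g) = conj (A (delta 1) 1) • delta g := by
    refine lp.ext (funext fun h => ?_)
    rw [star_apply_delta, hdelta, map_mul]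
    change _ = conj (A (delta 1) 1) * delta g h
    by_cases H : h = g
    · rw [H, delta_self, map_one]
    · rw [delta_of_ne H, delta_of_ne (Ne.symm H), map_zero]
  rw [← inner_delta_left, ← inner_star_apply, hstar, inner_smul_left, Complex.conj_conj,
    inner_delta_left]
  rfl

/-- The group von Neumann algebra of a nontrivial ICC group is a type `II₁` factor. -/
theorem isTypeIIOneFactor_groupVonNeumannAlgebra [Infinite Γ] (hΓ : IsICC Γ) :
    IsTypeIIOneFactor (groupVonNeumannAlgebra Γ) :=
  ⟨⟨StarSubalgebra.isClosed_topologicalClosure _, fun _ hA hc =>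
      exists_eq_smul_one_of_isICC hΓ hA fun g => hc _ (leftRegular_mem g)⟩,
    not_finiteDimensional_groupVonNeumannAlgebra, _, isTraceState_canonicalTrace Γ⟩

theorem IsICC.infinite [Nontrivial Γ] (hΓ : IsICC Γ) : Infinite Γ := by
  obtain ⟨g, hg⟩ := exists_ne (1 : Γ)
  exact Set.infinite_univ_iff.1 ((hΓ g hg).mono (Set.subset_univ _))

end GroupVonNeumannAlgebra

/-! ### Infinite words and the leaves they pass through. -/

namespace DTree

variable {d : ℕ}

/-- An infinite word `w` over the alphabet `Fin d` describes a descending path in the infinite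
`d`-ary tree. It passes through exactly one leaf of `T`, and `T.idx w` is the number of this leaf. -/
def idx : DTree d → Stream' (Fin d) → ℕ
  | leaf, _ => 0
  | node c, w => offset c w.head + idx (c w.head) w.tail

/-- The part of the path `w` below the leaf number `T.idx w` of `T`. -/
def rest : DTree d → Stream' (Fin d) → Stream' (Fin d)
  | leaf, w => w
  | node c, w => rest (c w.head) w.tail

theorem idx_lt (T : DTree d) (w : Stream' (Fin d)) : T.idx w < T.numLeaves := by
  induction T generalizing w with
  | leaf => exact Nat.one_pos
  | node c ih =>
    have h1 := offset_add_le_total c w.head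
    have h2 := ih w.head w.tail
    simp only [idx]
    omega

/-- Together with `eq_of_idx_eq_of_rest_eq` this identifies infinite words with pairs (leaf of `T`,
word below that leaf). -/
theorem exists_idx_rest (T : DTree d) {k : ℕ} (hk : k < T.numLeaves) (z : Stream' (Fin d)) :
    ∃ w, T.idx w = k ∧ T.rest w = z := by
  induction T generalizing k with
  | leaf =>
    simp only [numLeaves] at hk
    exact ⟨z, by simp only [idx]; omega, rfl⟩
  | node c ih =>
    obtain ⟨i, h1, h2⟩ := exists_block c k hk
    obtain ⟨w, hw, hz⟩ := ih i (k := k - offset c i) (by omega)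
    refine ⟨Stream'.cons i w, ?_, ?_⟩
    · simp only [idx, Stream'.head_cons, Stream'.tail_cons, hw]
      omega
    · simpa only [rest, Stream'.head_cons, Stream'.tail_cons] using hz

/-- The subtrees below the root occupy disjoint intervals of leaf numbers. -/
theorem head_eq_of_idx_eq {c : Fin d → DTree d} {w w' : Stream' (Fin d)}
    (h : (node c).idx w = (node c).idx w') : w.head = w'.head := by
  simp only [idx] at h
  have h1 := (c w.head).idx_lt w.tail
  have h2 := (c w'.head).idx_lt w'.tail
  rcases lt_trichotomy w.head w'.head with H | H | H
  · have := offset_add_le c H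
    omega
  · exact H
  · have := offset_add_le c H
    omega

theorem eq_of_idx_eq_of_rest_eq (T : DTree d) {w w' : Stream' (Fin d)} (h : T.idx w = T.idx w')
    (h' : T.rest w = T.rest w') : w = w' := by
  induction T generalizing w w' with
  | leaf => exact h'
  | node c ih =>
    have hh := head_eq_of_idx_eq h
    simp only [idx, rest, ← hh] at h h'
    rw [← Stream'.cons_head_tail w, ← Stream'.cons_head_tail w', hh,
      ih w.head (by omega) h']

/-- A larger tree induces a finer partition of the words. -/
theorem idx_eq_of_le {S T : DTree d} (hle : S.le T) {w w' : Stream' (Fin d)}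
    (h : T.idx w = T.idx w') : S.idx w = S.idx w' := by
  induction S generalizing T w w' with
  | leaf => rfl
  | node c ih =>
    cases T with
    | leaf => exact hle.elim
    | node c' =>
      have hh := head_eq_of_idx_eq h
      simp only [idx, ← hh] at h ⊢
      rw [ih w.head (hle w.head) (Nat.add_left_cancel h)]

/-- A tree is determined by the partition of the infinite words which it induces. -/
theorem eq_of_idx_eq_iff (hd : 2 ≤ d) {S T : DTree d}
    (h : ∀ w w', S.idx w = S.idx w' ↔ T.idx w = T.idx w') : S = T := by
  -- This is where `2 ≤ d` enters: for `d = 1` no tree separates any words.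
  have leaf_ne_node : ∀ c : Fin d → DTree d,
      ¬ ∀ w w', (node c).idx w = (node c).idx w' := by
    intro c H
    have := head_eq_of_idx_eq (H (Stream'.const ⟨0, by omega⟩) (Stream'.const ⟨1, by omega⟩))
    exact absurd (congrArg Fin.val this) (by simp [Stream'.head, Stream'.get, Stream'.const])
  induction S generalizing T with
  | leaf =>
    cases T with
    | leaf => rfl
    | node c' => exact (leaf_ne_node c' fun w w' => (h w w').1 rfl).elim
  | node c ih =>
    cases T with
    | leaf => exact (leaf_ne_node c fun w w' => (h w w').2 rfl).elim
    | node c' =>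
      refine congrArg node (funext fun i => ih i fun w w' => ?_)
      simpa only [idx, Stream'.head_cons, Stream'.tail_cons, Nat.add_left_cancel_iff] using
        h (Stream'.cons i w) (Stream'.cons i w')

/-- The effect of adding a caret on the leaf number and on the remaining path. -/
theorem idx_rest_addCaret (hd : 1 ≤ d) (T : DTree d) {k : ℕ} (hk : k < T.numLeaves)
    (w : Stream' (Fin d)) :
    (T.idx w < k → (T.addCaret k).idx w = T.idx w ∧ (T.addCaret k).rest w = T.rest w) ∧
    (T.idx w = k → (T.addCaret k).idx w = k + (T.rest w).head.val ∧
      (T.addCaret k).rest w = (T.rest w).tail) ∧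
    (k < T.idx w → (T.addCaret k).idx w = T.idx w + (d - 1) ∧
      (T.addCaret k).rest w = T.rest w) := by
  induction T generalizing k w with
  | leaf =>
    simp only [numLeaves] at hk
    obtain rfl : k = 0 := by omega
    refine ⟨fun h => by simp [idx] at h, fun _ => ?_, fun h => by simp [idx] at h⟩
    simp [addCaret, caret, idx, rest, offset, numLeaves]
  | node c ih =>
    obtain ⟨i, h1, h2⟩ := exists_block c k hk
    obtain ⟨k, rfl⟩ := Nat.exists_eq_add_of_le h1
    -- From here on `k` is the leaf number relative to the `i`th subtree.
    have e : ((offset c i + k : ℕ) : ℤ) - offset c i = (k : ℕ) := by push_cast; ring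
    rw [addCaret_node c i (by omega) (by omega), e]
    have hn := numLeaves_addCaret hd (c i) (k := k) (by omega) (by omega)
    have hlt := (c w.head).idx_lt w.tail
    rcases lt_trichotomy w.head i with H | H | H
    · have h3 := offset_add_le c H
      simp only [idx, rest, Function.update_of_ne H.ne, offset_update_of_le c _ H.le]
      exact ⟨fun _ => ⟨trivial, trivial⟩, fun _ => by omega, fun _ => by omega⟩
    · subst H
      have := ih w.head (k := k) (by omega) w.tail
      simp only [idx, rest, Function.update_self, offset_update_of_le c _ le_rfl,
        Nat.add_lt_add_iff_left, Nat.add_left_cancel_iff]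
      refine ⟨fun h => ?_, fun h => ?_, fun h => ?_⟩
      · exact ⟨(this.1 h).1, (this.1 h).2⟩
      · exact ⟨by rw [(this.2.1 h).1]; omega, (this.2.1 h).2⟩
      · exact ⟨by rw [(this.2.2 h).1]; omega, (this.2.2 h).2⟩
    · have h3 := offset_add_le c H
      have h4 := offset_update_of_lt c ((c i).addCaret k) H
      simp only [idx, rest, Function.update_of_ne H.ne']
      exact ⟨fun _ => by omega, fun _ => by omega, fun _ => ⟨by omega, trivial⟩⟩

end DTree

/-! ### The action of the Thompson-like group on infinite words. -/

namespace CloningSystem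

variable {d : ℕ} {G : ℕ → Type*} [∀ n, Group (G n)] (C : CloningSystem d G)

/-- The number of the leaf of `T₊` through which the path `w` passes. -/
def plusIdx (t : TreeTriple d G) (w : Stream' (Fin d)) : Fin t.n :=
  ⟨t.plus.idx w, t.plus_leaves ▸ t.plus.idx_lt w⟩

/-- The partial action of triples on infinite words: the triple `(T₋, g, T₊)` sends the words
passing through the `k`th leaf of `T₊` to those passing through the `ρ(g)(k)`th leaf of `T₋`,
leaving the remaining parts of the words unchanged. -/
def TripleSends (t : TreeTriple d G) (w y : Stream' (Fin d)) : Prop :=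
  t.minus.idx y = C.ρ t.n t.elt (plusIdx t w) ∧ t.minus.rest y = t.plus.rest w

theorem exists_tripleSends (t : TreeTriple d G) (w : Stream' (Fin d)) :
    ∃ y, C.TripleSends t w y :=
  t.minus.exists_idx_rest (by rw [t.minus_leaves]; exact Fin.isLt _) _

theorem TripleSends.right_unique {t : TreeTriple d G} {w y y' : Stream' (Fin d)}
    (h : C.TripleSends t w y) (h' : C.TripleSends t w y') : y = y' :=
  t.minus.eq_of_idx_eq_of_rest_eq (h.1.trans h'.1.symm) (h.2.trans h'.2.symm)

theorem TripleSends.inv {t : TreeTriple d G} {w y : Stream' (Fin d)} (h : C.TripleSends t w y) :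
    C.TripleSends (invTriple t) y w := by
  refine ⟨?_, h.2.symm⟩
  have h1 : plusIdx (invTriple t) y = C.ρ t.n t.elt (plusIdx t w) := Fin.ext h.1
  change _ = ((C.ρ t.n t.elt⁻¹ (plusIdx (invTriple t) y) : Fin t.n) : ℕ)
  rw [h1]
  rw [map_inv, Equiv.Perm.inv_def, Equiv.symm_apply_apply]
  rfl

/-- If `w` passes through leaf `k`, both carets move the same letter from the remaining word into
the leaf number, and the standard cloning map sends the `d` new strands to each other in order. Full
compatibility is essential here, since these are the points exempted in `ρ_κ`. -/
theorem TripleSends.expand (hfull : C.FullyCompatible) {t : TreeTriple d G} {w y : Stream' (Fin d)}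
    (h : C.TripleSends t w y) (k : Fin t.n) : C.TripleSends (C.expand t k) w y := by
  obtain ⟨h1, h2⟩ := h
  have hw := t.plus.idx_rest_addCaret C.one_le (k.isLt.trans_eq t.plus_leaves.symm) w
  have hy := t.minus.idx_rest_addCaret C.one_le
    ((C.ρ t.n t.elt k).isLt.trans_eq t.minus_leaves.symm) y
  rw [h1] at hy
  have hj : (plusIdx t w).val = t.plus.idx w := rfl
  rw [← hj] at hw
  generalize plusIdx t w = j at *
  set i := plusIdx (C.expand t k) w with hi
  have hi' : i.val = (t.plus.addCaret k.val).idx w := rfl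
  have hhead := (t.plus.rest w).head.isLt
  have hρ : (C.ρ (t.n + (d - 1)) (C.κ t.n k t.elt) i : ℕ) =
      standardCloneFun d t.n k (C.ρ t.n t.elt) i :=
    congrArg Fin.val (hfull t.n k t.elt i)
  -- The leaf of the expanded tree met by `w` comes from the leaf `j` met before.
  have hstrand : cloneStrand d t.n k i = j := by
    ext
    simp only [cloneStrand]
    rcases lt_trichotomy j.val k.val with H | H | H
    · have := (hw.1 H).1
      split_ifs <;> omega
    · have := (hw.2.1 H).1
      split_ifs <;> omega
    · have := (hw.2.2 H).1
      split_ifs <;> omega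
  change (t.minus.addCaret (C.ρ t.n t.elt k).val).idx y =
    (C.ρ (t.n + (d - 1)) (C.κ t.n k t.elt) i : ℕ) ∧
    (t.minus.addCaret (C.ρ t.n t.elt k).val).rest y = (t.plus.addCaret k.val).rest w
  rw [hρ]
  simp only [standardCloneFun, hstrand]
  by_cases hjk : j = k
  · subst hjk
    rw [if_pos rfl, (hy.2.1 rfl).1, (hy.2.1 rfl).2, (hw.2.1 rfl).2, h2]
    have := (hw.2.1 rfl).1
    exact ⟨by omega, rfl⟩
  · have hr : (t.plus.addCaret k.val).rest w = t.plus.rest w := by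
      rcases lt_or_gt_of_ne (Fin.val_ne_of_ne hjk) with H | H
      · exact (hw.1 H).2
      · exact (hw.2.2 H).2
    rw [if_neg hjk, hr, ← h2]
    have hne : C.ρ t.n t.elt j ≠ C.ρ t.n t.elt k := fun H => hjk ((C.ρ t.n t.elt).injective H)
    rcases lt_or_gt_of_ne hne with H | H
    · rw [if_pos H]
      exact hy.1 H
    · rw [if_neg H.asymm]
      exact hy.2.2 H

/-- Expansions preserve the relation; to descend from the common expansion to `b`, take the image of
`w` under `b` and compare it with `y` by uniqueness in the common expansion. -/
theorem TripleSends.of_cls_eq (hfull : C.FullyCompatible) {a b : TreeTriple d G}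
    (hab : C.cls a = C.cls b) {w y : Stream' (Fin d)} (h : C.TripleSends a w y) :
    C.TripleSends b w y := by
  have steps : ∀ {a b : TreeTriple d G} {y : Stream' (Fin d)}, C.Steps a b →
      C.TripleSends a w y → C.TripleSends b w y := by
    intro a b y hs h
    induction hs with
    | refl => exact h
    | tail _ hs ih =>
      obtain ⟨k, rfl⟩ := hs
      exact ih.expand C hfull k
  obtain ⟨e, ha, hb⟩ := C.cls_eq_iff.1 hab
  obtain ⟨y', hy'⟩ := C.exists_tripleSends b w
  rwa [(steps ha h).right_unique C (steps hb hy')]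

/-- The action of `𝒯_d(G_*)` on infinite words, as a relation. -/
def Sends (x : C.Thompson) (w y : Stream' (Fin d)) : Prop :=
  ∃ t, C.cls t = x ∧ C.TripleSends t w y

variable {C}

theorem sends_cls_iff (hfull : C.FullyCompatible) {t : TreeTriple d G} {w y : Stream' (Fin d)} :
    C.Sends (C.cls t) w y ↔ C.TripleSends t w y :=
  ⟨fun ⟨_, h, h'⟩ => h'.of_cls_eq C hfull h, fun h => ⟨t, rfl, h⟩⟩

theorem exists_sends (x : C.Thompson) (w : Stream' (Fin d)) : ∃ y, C.Sends x w y := by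
  obtain ⟨t, rfl⟩ := C.cls_surjective x
  obtain ⟨y, hy⟩ := C.exists_tripleSends t w
  exact ⟨y, t, rfl, hy⟩

theorem Sends.right_unique (hfull : C.FullyCompatible) {x : C.Thompson} {w y y' : Stream' (Fin d)}
    (h : C.Sends x w y) (h' : C.Sends x w y') : y = y' := by
  obtain ⟨t, rfl⟩ := C.cls_surjective x
  exact ((sends_cls_iff hfull).1 h).right_unique C ((sends_cls_iff hfull).1 h')

theorem Sends.inv {x : C.Thompson} {w y : Stream' (Fin d)} (h : C.Sends x w y) :
    C.Sends x⁻¹ y w := by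
  obtain ⟨t, rfl, h⟩ := h
  exact ⟨invTriple t, rfl, h.inv C⟩

theorem Sends.left_unique (hfull : C.FullyCompatible) {x : C.Thompson} {w w' y : Stream' (Fin d)}
    (h : C.Sends x w y) (h' : C.Sends x w' y) : w = w' :=
  h.inv.right_unique hfull h'.inv

theorem Sends.mul (hfull : C.FullyCompatible) {x x' : C.Thompson} {w y z : Stream' (Fin d)}
    (h' : C.Sends x y z) (h : C.Sends x' w y) : C.Sends (x * x') w z := by
  obtain ⟨_, a, b, c, hc, rfl, rfl, rfl⟩ := C.exists_prod x x'
  rw [Comp.cls_mul C hc]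
  have h' := (sends_cls_iff hfull).1 h'
  have h := (sends_cls_iff hfull).1 h
  obtain ⟨n, T, S, U, g, g', hT, hS, hU, rfl, rfl, rfl⟩ := hc
  refine ⟨_, rfl, ?_, h'.2.trans h.2⟩
  have e : plusIdx (⟨n, T, g, S, hT, hS⟩ : TreeTriple d G) y =
      C.ρ n g' (plusIdx (⟨n, S, g', U, hS, hU⟩ : TreeTriple d G) w) := Fin.ext h.1
  rw [h'.1]
  simp only [e, map_mul, Equiv.Perm.mul_apply]
  rfl

end CloningSystem

/-! ### Trees grown repeatedly at one leaf number. -/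

namespace DTree

variable {d : ℕ}

/-- The tree `T` with `a` carets added successively to the leaf number `k`. -/
def grow (T : DTree d) (k a : ℕ) : DTree d := (fun U => U.addCaret (k : ℤ))^[a] T

theorem grow_succ (T : DTree d) (k a : ℕ) : T.grow k (a + 1) = (T.grow k a).addCaret (k : ℤ) :=
  Function.iterate_succ_apply' _ _ _

theorem grow_add (T : DTree d) (k a b : ℕ) : T.grow k (a + b) = (T.grow k b).grow k a :=
  Function.iterate_add_apply _ _ _ _

theorem numLeaves_grow (hd : 1 ≤ d) (T : DTree d) {k : ℕ} (hk : k < T.numLeaves) (a : ℕ) :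
    (T.grow k a).numLeaves = T.numLeaves + a * (d - 1) := by
  induction a with
  | zero => simp [grow]
  | succ a ih =>
    rw [grow_succ, numLeaves_addCaret hd _ (by omega) (by rw [ih]; push_cast; omega), ih]
    ring

theorem lt_numLeaves_grow (hd : 1 ≤ d) (T : DTree d) {k : ℕ} (hk : k < T.numLeaves) (a : ℕ) :
    k < (T.grow k a).numLeaves := by
  rw [numLeaves_grow hd T hk]
  omega

theorem le_grow (T : DTree d) (k a : ℕ) : T.le (T.grow k a) := by
  induction a with
  | zero => exact le_refl T
  | succ a ih =>
    rw [grow_succ]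
    exact le_trans ih (le_addCaret _ _)

theorem idx_rest_grow_of_lt (hd : 1 ≤ d) (T : DTree d) {k : ℕ} (hk : k < T.numLeaves)
    {w : Stream' (Fin d)} (hw : T.idx w < k) (a : ℕ) :
    (T.grow k a).idx w = T.idx w ∧ (T.grow k a).rest w = T.rest w := by
  induction a with
  | zero => exact ⟨rfl, rfl⟩
  | succ a ih =>
    have := (idx_rest_addCaret hd (T.grow k a) (lt_numLeaves_grow hd T hk a) w).1
      (ih.1.trans_lt hw)
    rw [grow_succ, this.1, this.2]
    exact ih

theorem idx_rest_grow_of_gt (hd : 1 ≤ d) (T : DTree d) {k : ℕ} (hk : k < T.numLeaves)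
    {w : Stream' (Fin d)} (hw : k < T.idx w) (a : ℕ) :
    (T.grow k a).idx w = T.idx w + a * (d - 1) ∧ (T.grow k a).rest w = T.rest w := by
  induction a with
  | zero => exact ⟨by simp [grow], rfl⟩
  | succ a ih =>
    have := (idx_rest_addCaret hd (T.grow k a) (lt_numLeaves_grow hd T hk a) w).2.2
      (by rw [ih.1]; omega)
    rw [grow_succ, this.1, this.2, ih.1, ih.2]
    exact ⟨by ring, rfl⟩

end DTree

/-! ### Conjugacy classes in the Thompson-like group. -/

namespace CloningSystem

variable {d : ℕ} {G : ℕ → Type*} [∀ n, Group (G n)] {C : CloningSystem d G}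

variable (C) in
theorem step_expand (t : TreeTriple d G) (k : Fin t.n) : C.Step t (C.expand t k) := ⟨k, rfl⟩

variable (C) in
/-- If two triples with the same tree `T₊` have a common expansion, their group elements agree. -/
theorem elt_heq_of_steps {a b e : TreeTriple d G} (ha : C.Steps a e) (hb : C.Steps b e)
    (h : a.plus = b.plus) : HEq a.elt b.elt := by
  induction ha using Relation.ReflTransGen.head_induction_on generalizing b with
  | refl =>
    rw [C.steps_eq_of_n hb (by rw [← e.plus_leaves, h, b.plus_leaves])]
  | head hs hc ih =>
    obtain ⟨k, rfl⟩ := hs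
    rename_i a
    obtain ⟨n, T, g, S, hT, hS⟩ := a
    obtain ⟨m, T', g', S', hT', hS'⟩ := b
    obtain rfl : S = S' := h
    obtain rfl : n = m := hS.symm.trans hS'
    -- The second triple, expanded at the same leaf `k`, also reaches `e`, by `steps_unique`.
    -- Induction then identifies the clones under `κ_k`, which is injective.
    obtain ⟨e', he', hplus⟩ := C.exists_steps_plus (C.expand ⟨n, T', g', S, hT', hS'⟩ k)
      (W := e.plus) (C.steps_le hc :)
    obtain rfl : e' = e := C.steps_unique
      (.head (C.step_expand ⟨n, T', g', S, hT', hS'⟩ k) he') hb hplus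
    exact heq_of_eq (C.κ_injective n k (eq_of_heq (ih he' rfl)))

theorem elt_eq_of_cls_eq {n : ℕ} {T T' S : DTree d} {g g' : G n} {hT : T.numLeaves = n}
    {hT' : T'.numLeaves = n} {hS : S.numLeaves = n}
    (h : C.cls ⟨n, T, g, S, hT, hS⟩ = C.cls ⟨n, T', g', S, hT', hS⟩) : g = g' := by
  obtain ⟨e, h1, h2⟩ := C.cls_eq_iff.1 h
  exact eq_of_heq (C.elt_heq_of_steps h1 h2 rfl)

/-- Conjugation transplants the same group element onto any other tree with `n` leaves; this makes
different cloning maps comparable. -/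
theorem cls_conj {n : ℕ} {T U : DTree d} (g : G n) (hT : T.numLeaves = n) (hU : U.numLeaves = n) :
    C.cls ⟨n, U, 1, T, hU, hT⟩ * C.cls ⟨n, T, g, T, hT, hT⟩ * (C.cls ⟨n, U, 1, T, hU, hT⟩)⁻¹ =
      C.cls ⟨n, U, g, U, hU, hU⟩ := by
  rw [cls_inv, cls_mul_cls, cls_mul_cls, one_mul, inv_one, mul_one]

/-- Elements acting trivially on infinite words. -/
def ActsTrivially (x : C.Thompson) : Prop := ∀ w, C.Sends x w w

theorem ActsTrivially.conj (hfull : C.FullyCompatible) {x : C.Thompson} (hx : ActsTrivially x)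
    (f : C.Thompson) : ActsTrivially (f * x * f⁻¹) := by
  intro w
  obtain ⟨y, hy⟩ := exists_sends f⁻¹ w
  have hy' := hy.inv
  rw [inv_inv] at hy'
  exact (hy'.mul hfull (hx y)).mul hfull hy

/-- Apply the hypothesis with `R = T₋`: leaf `ρ(g)(k)` of `T₋` then contains exactly the words
through leaf `k` of `T₊`. Both trees induce the same partition, so they agree, and `ρ(g)` fixes
every leaf. -/
theorem eq_and_eq_one_of_forall_idx_eq {t : TreeTriple d G}
    (h : ∀ (R : DTree d) (w y), C.Sends (C.cls t) w y → R.idx y = R.idx w) :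
    t.minus = t.plus ∧ C.ρ t.n t.elt = 1 := by
  have hminus : ∀ w, t.minus.idx w = C.ρ t.n t.elt (plusIdx t w) := by
    intro w
    obtain ⟨y, hy⟩ := C.exists_tripleSends t w
    rw [← h t.minus w y ⟨t, rfl, hy⟩, hy.1]
  have heq : t.minus = t.plus := DTree.eq_of_idx_eq_iff C.two_le fun w w' => by
    rw [hminus, hminus, ← Fin.ext_iff, (C.ρ t.n t.elt).injective.eq_iff, Fin.ext_iff]
    rfl
  refine ⟨heq, Equiv.ext fun k => Fin.ext ?_⟩
  have : Nonempty (Fin d) := ⟨⟨0, C.one_le⟩⟩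
  obtain ⟨w, hw, -⟩ := t.plus.exists_idx_rest (k.isLt.trans_eq t.plus_leaves.symm)
    (Stream'.const (Classical.arbitrary (Fin d)))
  have hk : plusIdx t w = k := Fin.ext hw
  rw [← hk, ← hminus, heq]
  rfl

theorem ActsTrivially.eq_and_eq_one (hfull : C.FullyCompatible) {t : TreeTriple d G}
    (h : ActsTrivially (C.cls t)) : t.minus = t.plus ∧ C.ρ t.n t.elt = 1 :=
  eq_and_eq_one_of_forall_idx_eq fun _ w _ hy => by rw [hy.right_unique hfull (h w)]

/-- A moved word is separated from its image by a finite tree, which leaves room to modify the word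
far below. -/
theorem exists_idx_ne_of_not_actsTrivially {x : C.Thompson}
    (hx : ¬ ActsTrivially x) : ∃ (R : DTree d) (w y : _), C.Sends x w y ∧ R.idx y ≠ R.idx w := by
  by_contra! H
  obtain ⟨t, rfl⟩ := C.cls_surjective x
  obtain ⟨h1, h2⟩ := eq_and_eq_one_of_forall_idx_eq H
  refine hx fun w => ⟨t, rfl, ?_, by rw [h1]⟩
  rw [h1, h2]
  rfl

theorem infinite_conjugatesOf_of_not_actsTrivially (hfull : C.FullyCompatible) {x : C.Thompson}
    (hx : ¬ ActsTrivially x) : (conjugatesOf x).Infinite := by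
  have hd := C.one_le
  have hd2 := C.two_le
  -- A leaf `k` of a tree `S` and a word `w` through this leaf whose image avoids the leaf.
  obtain ⟨S, w, y, hsend, hne, h01⟩ : ∃ (S : DTree d) (w y : Stream' (Fin d)), C.Sends x w y ∧
      S.idx y ≠ S.idx w ∧ (S.rest w).head.val = 0 ∧ (S.rest w).tail.head.val = 1 := by
    obtain ⟨R, w₀, y₀, h₀, hne⟩ := exists_idx_ne_of_not_actsTrivially hx
    obtain ⟨t, rfl⟩ := C.cls_surjective x
    -- Expand until both trees contain `R`. Any word through the same leaf of `T₊` as `w₀` is then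
    -- still separated from its image by `R`.
    obtain ⟨t₁, ht₁, h₁⟩ := C.exists_steps_plus t (DTree.le_sup_left t.plus R)
    obtain ⟨t₂, ht₂, h₂⟩ := C.exists_steps_minus t₁ (DTree.le_sup_left t₁.minus R)
    have hplus : R.le t₂.plus :=
      DTree.le_trans (h₁ ▸ DTree.le_sup_right t.plus R) (C.steps_le ht₂)
    have hminus : R.le t₂.minus := h₂ ▸ DTree.le_sup_right t₁.minus R
    rw [C.cls_eq_of_steps ht₁, C.cls_eq_of_steps ht₂] at h₀ ⊢
    have h₀ := (sends_cls_iff hfull).1 h₀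
    -- Continuing with the letters `0, 1` puts `w` in leaf `k + 1` once two carets are added at leaf
    -- `k`.
    obtain ⟨w, hw, hz⟩ := t₂.plus.exists_idx_rest (t₂.plus.idx_lt w₀)
      (Stream'.cons (⟨0, by omega⟩ : Fin d) (Stream'.const ⟨1, by omega⟩))
    obtain ⟨y, hy⟩ := C.exists_tripleSends t₂ w
    refine ⟨t₂.plus, w, y, ⟨t₂, rfl, hy⟩, fun H => hne ?_, ?_, ?_⟩
    · have hidx : plusIdx t₂ w = plusIdx t₂ w₀ := Fin.ext hw
      rw [← DTree.idx_eq_of_le hminus (hy.1.trans ((congrArg _ (congrArg _ hidx)).trans h₀.1.symm))]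
      exact DTree.idx_eq_of_le hplus (H.trans hw)
    · rw [hz]
      rfl
    · rw [hz]
      rfl
  set k := S.idx w with hk
  have hkS : k < S.numLeaves := S.idx_lt w
  -- Leaf `k + 2 * (d - 1)` is the last one below the old leaf `k`. As `d ≥ 2`, it lies to the right
  -- of leaf `k + 1`, so growing there does not affect `w`.
  have hk2 : k + 2 * (d - 1) < (S.grow k 2).numLeaves := by
    rw [DTree.numLeaves_grow hd S hkS]
    omega
  have hw2 : (S.grow k 2).idx w = k + 1 := by
    have e1 := (S.idx_rest_addCaret hd hkS w).2.1 rfl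
    have e2 := ((S.grow k 1).idx_rest_addCaret hd (DTree.lt_numLeaves_grow hd S hkS 1) w).2.1
      (e1.1.trans (by omega))
    rw [DTree.grow_succ, e2.1]
    change k + ((S.addCaret k).rest w).head.val = _
    rw [e1.2, h01.2]
  have hleaves : ∀ a, (S.grow k (a + 2)).numLeaves = S.numLeaves + (a + 2) * (d - 1) :=
    fun a => DTree.numLeaves_grow hd S hkS (a + 2)
  have hleaves' : ∀ a, ((S.grow k 2).grow (k + 2 * (d - 1)) a).numLeaves =
      S.numLeaves + (a + 2) * (d - 1) := by
    intro a
    rw [DTree.numLeaves_grow hd _ hk2, DTree.numLeaves_grow hd S hkS]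
    ring
  -- Elements supported below the leaf `k`.
  let f : ℕ → TreeTriple d G := fun a =>
    ⟨_, S.grow k (a + 2), 1, (S.grow k 2).grow (k + 2 * (d - 1)) a, hleaves a, hleaves' a⟩
  have hf : ∀ a w y, C.TripleSends (f a) w y ↔
      (S.grow k (a + 2)).idx y = ((S.grow k 2).grow (k + 2 * (d - 1)) a).idx w ∧
      (S.grow k (a + 2)).rest y = ((S.grow k 2).grow (k + 2 * (d - 1)) a).rest w := by
    intro a w y
    simp only [TripleSends, f, map_one]
    rfl
  -- Both trees of `f a` grow only below leaf `k` of `S`, by the same number of leaves, so leaves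
  -- outside keep matching numbers.
  have hfy : ∀ a, C.Sends (C.cls (f a)) y y := by
    refine fun a => ⟨f a, rfl, (hf a y y).2 ?_⟩
    rcases lt_or_gt_of_ne hne with H | H
    · have h1 := S.idx_rest_grow_of_lt hd hkS H
      have h2 := (S.grow k 2).idx_rest_grow_of_lt hd hk2 (w := y) (by rw [(h1 2).1]; omega) a
      exact ⟨by rw [h2.1, (h1 _).1, (h1 _).1], by rw [h2.2, (h1 _).2, (h1 _).2]⟩
    · have h1 := S.idx_rest_grow_of_gt hd hkS H
      have h2 := (S.grow k 2).idx_rest_grow_of_gt hd hk2 (w := y) (by rw [(h1 2).1]; omega) a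
      exact ⟨by rw [h2.1, (h1 _).1, (h1 _).1]; ring, by rw [h2.2, (h1 _).2, (h1 _).2]⟩
  choose v hv using fun a => exists_sends (C.cls (f a)) w
  have hvidx : ∀ a, (S.grow k (a + 2)).idx (v a) = k + 1 := by
    intro a
    rw [((hf a w (v a)).1 ((sends_cls_iff hfull).1 (hv a))).1,
      ((S.grow k 2).idx_rest_grow_of_lt hd hk2 (w := w) (by omega) a).1, hw2]
  -- Each further caret at leaf `k` shifts the old leaf `k + 1` to the right by `d - 1 > 0`, so `v
  -- a` is no longer in leaf `k + 1` of the larger tree.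
  have hvinj : ∀ a b, a < b → v a ≠ v b := by
    intro a b hab H
    obtain ⟨c, rfl⟩ := Nat.exists_eq_add_of_lt hab
    have h1 := hvidx (a + c + 1)
    rw [← H, show a + c + 1 + 2 = (c + 1) + (a + 2) by ring, DTree.grow_add,
      ((S.grow k (a + 2)).idx_rest_grow_of_gt hd (DTree.lt_numLeaves_grow hd S hkS _)
        (w := v a) (by rw [hvidx]; omega) (c + 1)).1, hvidx] at h1
    have : 0 < (c + 1) * (d - 1) := Nat.mul_pos (by omega) (by omega)
    omega
  have hconj : ∀ a, C.Sends (C.cls (f a) * x * (C.cls (f a))⁻¹) (v a) y := fun a =>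
    ((hfy a).mul hfull hsend).mul hfull (hv a).inv
  refine Set.infinite_of_injective_forall_mem
    (f := fun a => C.cls (f a) * x * (C.cls (f a))⁻¹) (fun a b hab => ?_)
    fun a => isConj_iff.2 ⟨_, rfl⟩
  have hab : C.cls (f a) * x * (C.cls (f a))⁻¹ = C.cls (f b) * x * (C.cls (f b))⁻¹ := hab
  have hvv : v a = v b := (hab ▸ hconj a).left_unique hfull (hconj b)
  rcases lt_trichotomy a b with H | H | H
  · exact (hvinj a b H hvv).elim
  · exact H
  · exact (hvinj b a H hvv.symm).elim

/-- Take the union of the trees `T₊` of chosen representatives. All larger trees are allowed so that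
the number of leaves can be increased later. -/
theorem exists_plus_eq_of_finite {s : Set C.Thompson} (hs : s.Finite) :
    ∃ W : DTree d, ∀ W', W.le W' → ∀ x ∈ s, ∃ t, C.cls t = x ∧ t.plus = W' := by
  induction s, hs using Set.Finite.induction_on with
  | empty => exact ⟨.leaf, by simp⟩
  | @insert x s _ _ ih =>
    obtain ⟨W, hW⟩ := ih
    obtain ⟨t, rfl⟩ := C.cls_surjective x
    refine ⟨t.plus.sup W, fun W' h => ?_⟩
    rintro x (rfl | hx)
    · obtain ⟨t', h1, h2⟩ := C.exists_steps_plus t (DTree.le_trans (DTree.le_sup_left _ _) h)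
      exact ⟨t', (C.cls_eq_of_steps h1).symm, h2⟩
    · exact hW W' (DTree.le_trans (DTree.le_sup_right _ _) h) x hx

/-- Finiteness provides one tree `W` for the whole conjugacy class, so every conjugate shows a
`κ_k`-clone after a caret is added at leaf `k`; transplanting one element to all these trees puts it
in all the images. -/
theorem eq_one_of_actsTrivially_of_finite (hfull : C.FullyCompatible) (hdiv : C.Diverse)
    {x : C.Thompson} (hx : ActsTrivially x) (hfin : (conjugatesOf x).Finite) : x = 1 := by
  have hd := C.one_le
  obtain ⟨N, hN⟩ := hdiv
  obtain ⟨W, hW, hWN⟩ : ∃ W : DTree d, (∀ x' ∈ conjugatesOf x, ∃ t, C.cls t = x' ∧ t.plus = W) ∧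
      N ≤ W.numLeaves := by
    obtain ⟨W, hW⟩ := exists_plus_eq_of_finite hfin
    -- Each of the `N` carets adds `d - 1 ≥ 1` leaves.
    refine ⟨W.grow 0 N, hW _ (W.le_grow 0 N), ?_⟩
    rw [W.numLeaves_grow hd ((Nat.zero_le _).trans_lt (W.idx_lt (Stream'.const ⟨0, hd⟩)))]
    have := Nat.mul_le_mul_left N (show 1 ≤ d - 1 by have := C.two_le; omega)
    omega
  have hpos := W.idx_lt (Stream'.const ⟨0, hd⟩)
  generalize hn : W.numLeaves = n at hWN hpos
  have hleaves : ∀ k : Fin n, (W.addCaret (k.val : ℤ)).numLeaves = n + (d - 1) := fun k => by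
    rw [DTree.numLeaves_addCaret hd W (by omega) (by rw [hn]; exact_mod_cast k.isLt), hn]
  -- Every conjugate has a representative whose group element is a clone, for each `k`.
  have hclone : ∀ x' ∈ conjugatesOf x, ∀ k : Fin n, ∃ g : G n,
      x' = C.cls ⟨_, W.addCaret (k.val : ℤ), C.κ n k g, W.addCaret (k.val : ℤ), hleaves k,
        hleaves k⟩ := by
    intro x' hx' k
    obtain ⟨t, rfl, htW⟩ := hW x' hx'
    obtain ⟨f, hf⟩ := isConj_iff.1 hx'
    have htriv := hx.conj hfull f
    rw [hf] at htriv
    obtain ⟨h1, h2⟩ := htriv.eq_and_eq_one hfull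
    obtain ⟨m, T, g, S, hT, hS⟩ := t
    obtain rfl : S = W := htW
    obtain rfl : T = S := h1
    obtain rfl : m = n := hT.symm.trans hn
    refine ⟨g, (C.cls_eq_of_steps (.single (C.step_expand _ k))).trans (congrArg C.cls ?_)⟩
    refine TreeTriple.mk_congr ?_ rfl rfl
    change T.addCaret (C.ρ m g k).val = _
    -- Since `ρ(g) = 1`, both carets are attached at leaf `k`, so the two trees stay equal.
    rw [show C.ρ m g = 1 from h2]
    rfl
  obtain ⟨g₀, hg₀⟩ := hclone x (IsConj.refl x) ⟨0, by omega⟩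
  have hmem : C.κ n ⟨0, by omega⟩ g₀ ∈ ⋂ k : Fin n, Set.range (C.κ n k) := by
    refine Set.mem_iInter.2 fun k => ?_
    -- The conjugate by `[W_k, 1, W_0]` carries `(g₀)κ_0` over `W_k`, and by `hclone` it also
    -- carries some `(g)κ_k` there.
    obtain ⟨g, hg⟩ := hclone _ (isConj_iff.2
      ⟨C.cls ⟨_, W.addCaret (k.val : ℤ), 1, _, hleaves k, hleaves ⟨0, by omega⟩⟩, rfl⟩) k
    rw [hg₀, cls_conj] at hg
    exact ⟨g, (elt_eq_of_cls_eq hg).symm⟩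
  rw [hN n hWN, Set.mem_singleton_iff] at hmem
  rw [hg₀, hmem, ← C.one_eq_cls]

theorem isICC_thompson (hfull : C.FullyCompatible) (hdiv : C.Diverse) : IsICC C.Thompson := by
  intro x hx hfin
  by_cases h : ActsTrivially x
  · exact hx (eq_one_of_actsTrivially_of_finite hfull hdiv h hfin)
  · exact infinite_conjugatesOf_of_not_actsTrivially hfull h hfin

/-- The trivial group is vacuously ICC, so infinitude needs a witness: the class of two different
trees with the element `1`, which would act trivially only if the trees agreed. -/
theorem nontrivial_thompson (hfull : C.FullyCompatible) : Nontrivial C.Thompson := by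
  have hd := C.one_le
  have hcaret : (DTree.caret : DTree d).numLeaves = d := by simp [DTree.caret, DTree.numLeaves]
  have hleaves : ∀ k : ℕ, k < d → ((DTree.caret : DTree d).addCaret k).numLeaves = d + (d - 1) :=
    fun k hk => by
      rw [DTree.numLeaves_addCaret hd _ (by omega) (by rw [hcaret]; omega), hcaret]
  have h0 := hleaves 0 (by omega)
  have h1 := hleaves 1 C.two_le
  refine ⟨C.cls ⟨_, _, 1, _, h0, h1⟩, 1, fun h => ?_⟩
  have htriv : ActsTrivially (1 : C.Thompson) := fun w =>
    ⟨⟨1, .leaf, 1, .leaf, rfl, rfl⟩, rfl, by simp [DTree.idx, plusIdx], rfl⟩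
  have heq := (ActsTrivially.eq_and_eq_one hfull (h ▸ htriv)).1
  have hzero : DTree.offset (fun _ : Fin d => DTree.leaf) ⟨0, hd⟩ = 0 :=
    Finset.sum_eq_zero fun i hi => absurd (Finset.mem_Iio.1 hi) (by simp [Fin.lt_def])
  simp only [DTree.caret, DTree.addCaret, DTree.node.injEq] at heq
  -- The leftmost subtree is a caret in one tree and a leaf in the other.
  have := congrFun heq ⟨0, hd⟩
  simp [hzero] at this

end CloningSystem

theorem mainTheorem2 {d : ℕ} {G : ℕ → Type*} [∀ n, Group (G n)] (C : CloningSystem d G)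
    (hfull : C.FullyCompatible) (hdiv : C.Diverse) :
    IsICC C.Thompson ∧ IsTypeIIOneFactor (groupVonNeumannAlgebra C.Thompson) := by
  have hicc := CloningSystem.isICC_thompson hfull hdiv
  have := CloningSystem.nontrivial_thompson hfull
  have := hicc.infinite
  exact ⟨hicc, isTypeIIOneFactor_groupVonNeumannAlgebra hicc⟩
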